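/- Let $N\ge 2$ be an integer, $c>0$, $R>0$, and let $f:[0,\infty)\to\mathbb{R}$ be continuous at $0$ and differentiable at $R$. Consider $N+1$ vortices $z_1,\dots,z_{N+1}\in\mathbb{C}$ governed by $$\dot z_j = i f(|z_j|)z_j + ic\sum_{k\ne j}\frac{z_j-z_k}{|z_j-z_k|^2},\qquad j=1,\dots,N+1, \qquad (1)$$ and the configuration $\xi=(\xi_1,\dots,\xi_{N+1})$ with $\xi_j=Re^{2\pi i j/N}$ for $1\le j\le N$ and $\xi_{N+1}=0$ ($N$ vortices on a ring of radius $R$ and one at the center). (a) For $\omega\in\mathbb{R}$, $z(t)=e^{i\omega t}\xi$ is a solution of (1) (a relative equilibrium) if and only if $$\omega=f(R)+\frac{c(N+1)}{2R^2}.$$ For this $\omega$, consider the associated aggregation equation $$\dot x_j=(f(|x_j|)-\omega)x_j+c\sum_{k\ne j}\frac{x_j-x_k}{|x_j-x_k|^2},\qquad j=1,\dots,N+1. \qquad (2)$$ Call $\xi$ *stable* for (2) if it is an equilibrium of (2) and all eigenvalues of the linearization of (2) at $\xi$ have negative real part, except for one algebraically simple eigenvalue $0$, whose eigenvector is the infinitesimal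 rotation $i\xi$. Call the relative equilibrium $e^{i\omega t}\xi$ *neutrally stable* for (1) if all eigenvalues of the linearization of (1) at $\xi$, in the frame rotating with angular velocity $\omega$, are purely imaginary. Let $$\lambda_+(m)=f'(R)R+\frac{c}{2R^2}\bigl[(m-1)(N-m-1)-(N-1)\bigr],\qquad \lambda_+^*(m)=\lambda_+(m)-\frac{2c}{R^2},$$ $$M_0=\begin{pmatrix} f'(R)\frac R2-\frac{c(N+1)}{2R^2} & f'(R)\frac R2-\frac{c}{R^2} & \frac{c}{R^2}\\ f'(R)\frac R2-\frac{c}{R^2} & f'(R)\frac R2-\frac{c(N+1)}{2R^2} & 0\\ \frac{cN}{R^2} & 0 & f(0)-f(R)-\frac{c(N+1)}{2R^2}\end{pmatrix}.$$ (b) If $N\ge3$, then the $N+1$ configuration $\xi$ is stable for (2) if and only if $\lambda_+^*(\lfloor N/2\rfloor)<0$ and all eigenvalues of $M_0$ are negative. If $N=2$, these two conditions are necessary for stability. (c) If $\xi$ is stable for (2), then the relative equilibrium $e^{i\omega t}\xi$ is neutrally stable for (1). -/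

import Mathlib

noncomputable section

namespace Vortex

/-- The right-hand side of the vortex equation
`z_j' = i f(|z_j|) z_j + i c ∑_{k ≠ j} (z_j - z_k) / |z_j - z_k|²`,
for vortices labelled by a finite type `ι`. -/
def vortexField {ι : Type*} [Fintype ι] [DecidableEq ι] (f : ℝ → ℝ) (c : ℝ)
    (z : ι → ℂ) : ι → ℂ := fun j =>
  Complex.I * (f ‖z j‖ : ℂ) * z j
    + Complex.I * (c : ℂ) *
      ∑ k ∈ Finset.univ.erase j, (z j - z k) / ((‖z j - z k‖ ^ 2 : ℝ) : ℂ)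

/-- `z` is a solution, for all times, of the vortex equation. -/
def IsVortexSolution {ι : Type*} [Fintype ι] [DecidableEq ι] (f : ℝ → ℝ) (c : ℝ)
    (z : ℝ → ι → ℂ) : Prop :=
  ∀ (t : ℝ) (j : ι), HasDerivAt (fun s => z s j) (vortexField f c (z t) j) t

/-- The vortex equation in the frame rotating with angular velocity `ω`: `z_j(t) = e^{iωt} x_j(t)`
solves the vortex equation iff `x` solves `x_j' = (rotatingVortexField f c ω x)_j`. -/
def rotatingVortexField {ι : Type*} [Fintype ι] [DecidableEq ι] (f : ℝ → ℝ) (c ω : ℝ)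
    (x : ι → ℂ) : ι → ℂ := fun j =>
  vortexField f c x j - Complex.I * (ω : ℂ) * x j

/-- The right-hand side of the aggregation equation
`x_j' = (f(|x_j|) - ω) x_j + c ∑_{k ≠ j} (x_j - x_k) / |x_j - x_k|²`. -/
def aggregationField {ι : Type*} [Fintype ι] [DecidableEq ι] (f : ℝ → ℝ) (c ω : ℝ)
    (x : ι → ℂ) : ι → ℂ := fun j =>
  ((f ‖x j‖ - ω : ℝ) : ℂ) * x j
    + (c : ℂ) * ∑ k ∈ Finset.univ.erase j, (x j - x k) / ((‖x j - x k‖ ^ 2 : ℝ) : ℂ)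

/-- The `N + 1` configuration: `N` vortices at the vertices of a regular polygon of radius `R`
centred at the origin, and one vortex (labelled `none`) at the origin. -/
def ringPlusCenter (N : ℕ) (R : ℝ) : Option (Fin N) → ℂ
  | some j => (R : ℂ) * Complex.exp (2 * (Real.pi : ℂ) * Complex.I * ((j : ℕ) : ℂ) / (N : ℂ))
  | none => 0

/-- The `N + 1` configuration rotating rigidly with angular velocity `ω`. -/
def rotatingRingPlusCenter (N : ℕ) (R ω : ℝ) (t : ℝ) : Option (Fin N) → ℂ := fun j =>
  Complex.exp (Complex.I * (ω : ℂ) * (t : ℂ)) * ringPlusCenter N R j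

/-- `μ : ℂ` is an eigenvalue (of the complexification) of the real-linear map `A`. -/
def IsComplexEigenvalue {V : Type*} [AddCommGroup V] [Module ℝ V] (A : V →ₗ[ℝ] V)
    (μ : ℂ) : Prop :=
  Module.End.HasEigenvalue (A.baseChange ℂ) μ

/-- The infinitesimal rotation `d/dθ (e^{iθ} x)` at `θ = 0`. -/
def rotationMode {ι : Type*} (x : ι → ℂ) : ι → ℂ := fun j => Complex.I * x j

/-- Linear (asymptotic) stability, modulo rotations, of an equilibrium `x` of a rotation-invariant
vector field `F`: all eigenvalues of the linearization of `F` at `x` have negative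
real part, except for the eigenvalue `0` forced by rotation invariance, which is algebraically
simple. -/
def IsLinearlyStable {ι : Type*} [Fintype ι] (F : (ι → ℂ) → (ι → ℂ)) (x : ι → ℂ) : Prop :=
  F x = 0 ∧ ∃ A : (ι → ℂ) →L[ℝ] (ι → ℂ), HasFDerivAt F A x ∧
    (∀ μ : ℂ, IsComplexEigenvalue (A : (ι → ℂ) →ₗ[ℝ] (ι → ℂ)) μ → μ.re < 0 ∨ μ = 0) ∧
    Module.End.maxGenEigenspace (A : (ι → ℂ) →ₗ[ℝ] (ι → ℂ)) 0
      = Submodule.span ℝ {rotationMode x}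

/-- Neutral linear stability of an equilibrium `x` of `F`: all eigenvalues of
the linearization of `F` at `x` are purely imaginary. -/
def IsNeutrallyStable {ι : Type*} [Fintype ι] (F : (ι → ℂ) → (ι → ℂ)) (x : ι → ℂ) : Prop :=
  F x = 0 ∧ ∃ A : (ι → ℂ) →L[ℝ] (ι → ℂ), HasFDerivAt F A x ∧
    ∀ μ : ℂ, IsComplexEigenvalue (A : (ι → ℂ) →ₗ[ℝ] (ι → ℂ)) μ → μ.re = 0

/-- `λ₊(m) = f'(R) R + c / (2 R²) * ((m - 1) (N - m - 1) - (N - 1))`. -/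
def lambdaPlus (f : ℝ → ℝ) (c R : ℝ) (N m : ℕ) : ℝ :=
  deriv f R * R
    + c / (2 * R ^ 2) * (((m : ℝ) - 1) * ((N : ℝ) - (m : ℝ) - 1) - ((N : ℝ) - 1))

/-- `λ₊*(m) = λ₊(m) - 2 c / R²`. -/
def lambdaPlusStar (f : ℝ → ℝ) (c R : ℝ) (N m : ℕ) : ℝ :=
  lambdaPlus f c R N m - 2 * c / R ^ 2

/-- The matrix `M₀` coupling the first ring mode to the central vortex. -/
def M0 (f : ℝ → ℝ) (c R : ℝ) (N : ℕ) : Matrix (Fin 3) (Fin 3) ℝ :=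
  !![deriv f R * (R / 2) - c * ((N : ℝ) + 1) / (2 * R ^ 2), deriv f R * (R / 2) - c / R ^ 2,
      c / R ^ 2;
    deriv f R * (R / 2) - c / R ^ 2, deriv f R * (R / 2) - c * ((N : ℝ) + 1) / (2 * R ^ 2),
      0;
    c * (N : ℝ) / R ^ 2, 0, f 0 - f R - c * ((N : ℝ) + 1) / (2 * R ^ 2)]

/-- All (complex) eigenvalues of the real square matrix `M` are negative real numbers. -/
def AllEigenvaluesNegative {n : Type*} [Fintype n] [DecidableEq n] (M : Matrix n n ℝ) : Prop :=
  ∀ μ ∈ spectrum ℂ (M.map (fun a : ℝ => (a : ℂ))), μ.im = 0 ∧ μ.re < 0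

/-- The stability criterion for the `N + 1` configuration: `λ₊*(⌊N/2⌋) < 0`, and all eigenvalues
of `M₀` are negative. -/
def StabilityCriterion (f : ℝ → ℝ) (c R : ℝ) (N : ℕ) : Prop :=
  lambdaPlusStar f c R N (N / 2) < 0 ∧ AllEigenvaluesNegative (M0 f c R N)

end Vortex

end

/-
Rotation and multiplication by `i` turn the vortex field in the rotating frame into `i` times the
aggregation field `F`, so both parts concern `F`. Its derivative `A` at `ξ` is self-adjoint for the
Euclidean inner product: stability makes `A` negative semidefinite, and `i A v = μ v` with `A`
semidefinite and `i` skew forces `μ` to be purely imaginary, which is (c).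

For (b), `A` couples, in the Fourier coefficients `X n` of the ring, only `X (1 + m)` with
`conj (X (1 - m))`, by a symmetric `2 × 2` block with eigenvalues `λ₊*(m)` and
`-c m (N - m) / (2 R²)`; the central vortex joins the block `m = 1`, which becomes `M₀` on
`(X 2, conj (X 0), N conj h)`. The case `m = 0` gives the rotation mode, and `λ₊*` is largest at
`⌊N/2⌋`. When `N = 2` the coefficients `X 2` and `X 0` coincide, and necessity of the condition
on `M₀` survives by adding the quadratic form of `A` over a real mode and its quarter turn.
-/

open scoped ComplexConjugate TensorProduct

namespace Vortex

section ComplexEigenvalue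

variable {V : Type*} [AddCommGroup V] [Module ℝ V] {A : V →ₗ[ℝ] V}

theorem exists_eq_one_tmul_add_I_tmul (z : ℂ ⊗[ℝ] V) :
    ∃ p q : V, z = 1 ⊗ₜ p + Complex.I ⊗ₜ q := by
  obtain ⟨b, rfl⟩ := TensorProduct.eq_repr_basis_left Complex.basisOneI z
  exact ⟨b 0, b 1, by simp [Finsupp.sum_fintype]⟩

theorem one_tmul_add_I_tmul_inj {p q p' q' : V} :
    (1 ⊗ₜ p + Complex.I ⊗ₜ q : ℂ ⊗[ℝ] V) = 1 ⊗ₜ p' + Complex.I ⊗ₜ q' ↔ p = p' ∧ q = q' := by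
  refine ⟨fun h => ?_, fun ⟨hp, hq⟩ => by rw [hp, hq]⟩
  have hcoord := fun i => congr(TensorProduct.equivFinsuppOfBasisLeft Complex.basisOneI $h i)
  exact ⟨by simpa using hcoord 0, by simpa using hcoord 1⟩

theorem smul_one_tmul_add_I_tmul (μ : ℂ) (p q : V) :
    μ • (1 ⊗ₜ p + Complex.I ⊗ₜ q : ℂ ⊗[ℝ] V)
      = 1 ⊗ₜ (μ.re • p - μ.im • q) + Complex.I ⊗ₜ (μ.im • p + μ.re • q) := by
  have hμ : μ = μ.re • 1 + μ.im • Complex.I := by simp [Complex.re_add_im]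
  have hμI : μ * Complex.I = μ.re • Complex.I - μ.im • 1 := by
    apply Complex.ext <;> simp
  rw [smul_add, TensorProduct.smul_tmul', TensorProduct.smul_tmul', smul_eq_mul, smul_eq_mul,
    hμI, mul_one]
  nth_rewrite 1 [hμ]
  simp only [TensorProduct.add_tmul, TensorProduct.sub_tmul, TensorProduct.tmul_add,
    TensorProduct.tmul_sub, TensorProduct.smul_tmul]
  abel

theorem isComplexEigenvalue_iff {μ : ℂ} : IsComplexEigenvalue A μ ↔
    ∃ p q : V, (p ≠ 0 ∨ q ≠ 0) ∧ A p = μ.re • p - μ.im • q ∧ A q = μ.im • p + μ.re • q := by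
  have eigen_iff (p q : V) : (1 ⊗ₜ p + Complex.I ⊗ₜ q : ℂ ⊗[ℝ] V) ∈
      Module.End.eigenspace (A.baseChange ℂ) μ ↔
      A p = μ.re • p - μ.im • q ∧ A q = μ.im • p + μ.re • q := by
    rw [Module.End.mem_eigenspace_iff, smul_one_tmul_add_I_tmul, map_add,
      LinearMap.baseChange_tmul, LinearMap.baseChange_tmul, one_tmul_add_I_tmul_inj]
  have ne_zero_iff (p q : V) : (1 ⊗ₜ p + Complex.I ⊗ₜ q : ℂ ⊗[ℝ] V) ≠ 0 ↔ p ≠ 0 ∨ q ≠ 0 := by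
    have := one_tmul_add_I_tmul_inj (p := p) (q := q) (p' := 0) (q' := 0)
    rw [TensorProduct.tmul_zero, TensorProduct.tmul_zero, add_zero] at this
    rw [Ne, this, not_and_or]
  constructor
  · intro h
    obtain ⟨z, hz, hz0⟩ := h.exists_hasEigenvector
    obtain ⟨p, q, rfl⟩ := exists_eq_one_tmul_add_I_tmul z
    exact ⟨p, q, (ne_zero_iff p q).1 hz0, (eigen_iff p q).1 hz⟩
  · rintro ⟨p, q, hpq, hA⟩
    exact Module.End.hasEigenvalue_of_hasEigenvector
      ⟨(eigen_iff p q).2 hA, (ne_zero_iff p q).2 hpq⟩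

theorem isComplexEigenvalue_ofReal {l : ℝ} (h : Module.End.HasEigenvalue A l) :
    IsComplexEigenvalue A l := by
  obtain ⟨v, hv⟩ := h.exists_hasEigenvector
  exact isComplexEigenvalue_iff.2 ⟨v, 0, .inl hv.2, by simp [hv.apply_eq_smul]⟩

end ComplexEigenvalue

section SelfAdjoint

open LinearMap (BilinForm)

variable {V : Type*} [AddCommGroup V] [Module ℝ V] {B : BilinForm ℝ V} {A : V →ₗ[ℝ] V}

theorem im_eq_zero_of_isSelfAdjoint (hpos : B.toQuadraticMap.PosDef) (hA : B.IsSelfAdjoint A)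
    {μ : ℂ} (hμ : IsComplexEigenvalue A μ) : μ.im = 0 := by
  obtain ⟨p, q, hpq, hp, hq⟩ := isComplexEigenvalue_iff.1 hμ
  have hsym : B (A p) q = B p (A q) := hA p q
  have himp : μ.im * (B p p + B q q) = 0 := by
    simp only [hp, hq, map_sub, map_add, map_smul, LinearMap.sub_apply, LinearMap.smul_apply,
      smul_eq_mul] at hsym
    linarith
  have hp0 : 0 ≤ B p p := hpos.nonneg p
  have hq0 : 0 ≤ B q q := hpos.nonneg q
  refine (mul_eq_zero.1 himp).resolve_right (ne_of_gt ?_)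
  rcases hpq with hp' | hq'
  · exact add_pos_of_pos_of_nonneg (hpos p hp') hq0
  · exact add_pos_of_nonneg_of_pos hp0 (hpos q hq')

theorem hasEigenvalue_re_of_isSelfAdjoint (hpos : B.toQuadraticMap.PosDef)
    (hA : B.IsSelfAdjoint A) {μ : ℂ} (hμ : IsComplexEigenvalue A μ) :
    Module.End.HasEigenvalue A μ.re := by
  have him := im_eq_zero_of_isSelfAdjoint hpos hA hμ
  obtain ⟨p, q, hpq, hp, hq⟩ := isComplexEigenvalue_iff.1 hμ
  rw [him, zero_smul, sub_zero] at hp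
  rw [him, zero_smul, zero_add] at hq
  rcases hpq with hp' | hq'
  · exact Module.End.hasEigenvalue_of_hasEigenvector
      ⟨Module.End.mem_eigenspace_iff.2 hp, hp'⟩
  · exact Module.End.hasEigenvalue_of_hasEigenvector
      ⟨Module.End.mem_eigenspace_iff.2 hq, hq'⟩

theorem eigenvalue_neg_of_apply_self_neg (hpos : B.toQuadraticMap.PosDef)
    (hneg : ∀ v ≠ 0, B v (A v) < 0) {l : ℝ} (hl : Module.End.HasEigenvalue A l) : l < 0 := by
  obtain ⟨v, hv⟩ := hl.exists_hasEigenvector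
  have := hneg v hv.2
  rw [hv.apply_eq_smul, map_smul, smul_eq_mul] at this
  exact neg_of_mul_neg_left this (hpos v hv.2).le

theorem maxGenEigenspace_zero_of_isSelfAdjoint (hpos : B.toQuadraticMap.PosDef)
    (hA : B.IsSelfAdjoint A) : Module.End.maxGenEigenspace A 0 = LinearMap.ker A := by
  have apply_eq_zero {v : V} (h : A (A v) = 0) : A v = 0 := by
    refine hpos.anisotropic _ ?_
    change B (A v) (A v) = 0
    rw [hA, h, map_zero]
  have pow_apply_eq_zero (k : ℕ) : ∀ v, (A ^ k) v = 0 → A v = 0 := by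
    induction k with
    | zero => exact fun v hv => by rw [show v = 0 from hv, map_zero]
    | succ k ih => exact fun v hv => apply_eq_zero (ih (A v) (by rwa [pow_succ] at hv))
  ext v
  simp only [Module.End.mem_maxGenEigenspace, zero_smul, sub_zero, LinearMap.mem_ker]
  exact ⟨fun ⟨k, hk⟩ => pow_apply_eq_zero k v hk, fun hv => ⟨1, by rwa [pow_one]⟩⟩

theorem inner_apply_self_nonpos {E : Type*} [NormedAddCommGroup E] [InnerProductSpace ℝ E]
    [FiniteDimensional ℝ E] {T : E →ₗ[ℝ] E} (hT : T.IsSymmetric)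
    (hl : ∀ l, Module.End.HasEigenvalue T l → l ≤ 0) (v : E) : inner ℝ v (T v) ≤ 0 := by
  let b := hT.eigenvectorBasis rfl
  rw [← b.sum_inner_mul_inner v (T v)]
  refine Finset.sum_nonpos fun i _ => ?_
  have hb : inner ℝ (b i) (T v) = hT.eigenvalues rfl i * inner ℝ (b i) v := by
    rw [← hT, hT.apply_eigenvectorBasis rfl i]
    exact real_inner_smul_left _ _ _
  rw [hb, real_inner_comm, mul_left_comm]
  exact mul_nonpos_of_nonpos_of_nonneg (hl _ (hT.hasEigenvalue_eigenvalues rfl i))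
    (mul_self_nonneg _)

theorem apply_self_nonpos_of_isSelfAdjoint [FiniteDimensional ℝ V] (hB : B.IsSymm)
    (hpos : B.toQuadraticMap.PosDef) (hA : B.IsSelfAdjoint A)
    (hl : ∀ l, Module.End.HasEigenvalue A l → l ≤ 0) (v : V) : B v (A v) ≤ 0 := by
  let core : InnerProductSpace.Core ℝ V :=
    { inner := fun x y => B x y
      conj_inner_symm := fun x y => hB.eq y x
      re_inner_nonneg := fun x => hpos.nonneg x
      add_left := fun x y z => by simp
      smul_left := fun x y r => by simp
      definite := fun x hx => hpos.anisotropic x hx }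
  let _ := core.toNormedAddCommGroup
  let _ := InnerProductSpace.ofCore core.toCore
  exact inner_apply_self_nonpos (T := A) hA hl v

theorem apply_eq_zero_of_apply_self_eq_zero (hB : B.IsSymm) (hpos : B.toQuadraticMap.PosDef)
    (hA : B.IsSelfAdjoint A) (hneg : ∀ v, B v (A v) ≤ 0) {v : V} (hv : B v (A v) = 0) :
    A v = 0 := by
  let Q : BilinForm ℝ V := -B.compl₂ A
  have hQ : v ∈ LinearMap.ker Q := by
    refine (LinearMap.BilinForm.apply_apply_same_eq_zero_iff Q (fun w => ?_) ⟨fun x y => ?_⟩).1 ?_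
    · simpa [Q] using hneg w
    · have := hB.eq (A x) y
      simpa [Q, hA x y] using this
    · simpa [Q] using hv
  have hQv : Q v (A v) = 0 := by rw [LinearMap.mem_ker.1 hQ, LinearMap.zero_apply]
  refine hpos.anisotropic _ ?_
  change B (A v) (A v) = 0
  simpa [Q, hA v (A v)] using hQv

theorem re_eq_zero_of_isComplexEigenvalue_comp {J : V →ₗ[ℝ] V} (hB : B.IsSymm)
    (hpos : B.toQuadraticMap.PosDef) (hA : B.IsSelfAdjoint A) (hneg : ∀ v, B v (A v) ≤ 0)
    (hJ : ∀ v, B v (J v) = 0) {μ : ℂ} (hμ : IsComplexEigenvalue (J ∘ₗ A) μ) : μ.re = 0 := by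
  obtain ⟨p, q, hpq, hp, hq⟩ := isComplexEigenvalue_iff.1 hμ
  rw [LinearMap.comp_apply] at hp hq
  have hsym : B (A q) p = B (A p) q := by
    rw [hA q p]
    exact hB.eq q (A p)
  have hp' : μ.re * B (A p) p = μ.im * B (A p) q := by
    have := hJ (A p)
    rw [hp, map_sub, map_smul, map_smul, smul_eq_mul, smul_eq_mul] at this
    linarith
  have hq' : μ.re * B (A q) q = -(μ.im * B (A p) q) := by
    have := hJ (A q)
    rw [hq, map_add, map_smul, map_smul, smul_eq_mul, smul_eq_mul, hsym] at this
    linarith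
  by_contra hre
  have hsum : B p (A p) + B q (A q) = 0 := by
    rw [← hA, ← hA]
    exact (mul_eq_zero.1 (by linear_combination hp' + hq')).resolve_left hre
  have hAp : A p = 0 := apply_eq_zero_of_apply_self_eq_zero hB hpos hA hneg
    (le_antisymm (hneg p) (by linarith [hneg q]))
  have hAq : A q = 0 := apply_eq_zero_of_apply_self_eq_zero hB hpos hA hneg
    (le_antisymm (hneg q) (by linarith [hneg p]))
  rw [hAp, map_zero] at hp
  rw [hAq, map_zero] at hq
  have hne : μ.re ^ 2 + μ.im ^ 2 ≠ 0 := by positivity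
  have hp0 : (μ.re ^ 2 + μ.im ^ 2) • p = 0 := by
    linear_combination (norm := module) -μ.re • hp - μ.im • hq
  have hq0 : (μ.re ^ 2 + μ.im ^ 2) • q = 0 := by
    linear_combination (norm := module) μ.im • hp - μ.re • hq
  exact hpq.elim (· ((smul_eq_zero_iff_right hne).1 hp0)) (· ((smul_eq_zero_iff_right hne).1 hq0))

end SelfAdjoint

section Matrix

variable {n : Type*} [Fintype n] [DecidableEq n] {M : Matrix n n ℝ}

theorem isComplexEigenvalue_toLin'_iff {μ : ℂ} : IsComplexEigenvalue (Matrix.toLin' M) μ ↔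
    μ ∈ spectrum ℂ (M.map fun a : ℝ => (a : ℂ)) := by
  rw [IsComplexEigenvalue, Module.End.hasEigenvalue_iff_isRoot_charpoly,
    LinearMap.charpoly_baseChange, Matrix.mem_spectrum_iff_isRoot_charpoly, Matrix.charpoly_toLin']
  exact iff_of_eq congr(Polynomial.IsRoot $((M.charpoly_map Complex.ofRealHom).symm) μ)

theorem eq_zero_of_mulVec_eq_smul (hM : AllEigenvaluesNegative M) {l : ℝ} (hl : 0 ≤ l)
    {u : n → ℂ} (hu : (M.map fun a : ℝ => (a : ℂ)).mulVec u = (l : ℂ) • u) : u = 0 := by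
  by_contra hu0
  have hmem : (l : ℂ) ∈ spectrum ℂ (M.map fun a : ℝ => (a : ℂ)) := by
    rw [← Matrix.spectrum_toLin', ← Module.End.hasEigenvalue_iff_mem_spectrum]
    exact Module.End.hasEigenvalue_of_hasEigenvector
      ⟨Module.End.mem_eigenspace_iff.2 (by rwa [Matrix.toLin'_apply]), hu0⟩
  exact hl.not_gt (hM l hmem).2

theorem allEigenvaluesNegative_of_apply_self_neg {B : LinearMap.BilinForm ℝ (n → ℝ)}
    (hpos : B.toQuadraticMap.PosDef) (hself : B.IsSelfAdjoint (Matrix.toLin' M))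
    (hneg : ∀ u ≠ 0, B u (M.mulVec u) < 0) : AllEigenvaluesNegative M := by
  intro μ hμ
  rw [← isComplexEigenvalue_toLin'_iff] at hμ
  exact ⟨im_eq_zero_of_isSelfAdjoint hpos hself hμ, eigenvalue_neg_of_apply_self_neg hpos
    (A := Matrix.toLin' M) hneg (hasEigenvalue_re_of_isSelfAdjoint hpos hself hμ)⟩

end Matrix

section RealDot

variable {ι : Type*} [Fintype ι]

/-- The Euclidean inner product `∑ⱼ Re (conj xⱼ yⱼ)` of configurations `ι → ℂ`, as a real bilinear
form: the type `ι → ℂ` itself carries the sup norm. -/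
noncomputable def realDot : LinearMap.BilinForm ℝ (ι → ℂ) :=
  ∑ j, (innerₗ ℂ).compl₁₂ (LinearMap.proj j) (LinearMap.proj j)

theorem realDot_apply (x y : ι → ℂ) : realDot x y = ∑ j, (conj (x j) * y j).re := by
  simp [realDot, LinearMap.sum_apply, mul_comm]

theorem realDot_isSymm : (realDot : LinearMap.BilinForm ℝ (ι → ℂ)).IsSymm := by
  refine ⟨fun x y => ?_⟩
  simp [realDot_apply, mul_comm]

theorem realDot_posDef : (realDot : LinearMap.BilinForm ℝ (ι → ℂ)).toQuadraticMap.PosDef := by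
  intro x hx
  obtain ⟨j, hj⟩ := Function.ne_iff.1 hx
  change 0 < realDot x x
  simp only [realDot_apply, Complex.conj_mul', ← Complex.ofReal_pow, Complex.ofReal_re]
  exact Finset.sum_pos' (fun k _ => sq_nonneg _)
    ⟨j, Finset.mem_univ j, pow_pos (norm_pos_iff.2 hj) 2⟩

theorem realDot_rotationMode_self (x : ι → ℂ) : realDot x (rotationMode x) = 0 := by
  rw [realDot_apply]
  exact Finset.sum_eq_zero fun j _ => by
    simp only [rotationMode, Complex.mul_re, Complex.conj_re, Complex.I_re, zero_mul, Complex.I_im,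
      one_mul, zero_sub, mul_neg, Complex.conj_im, Complex.mul_im, zero_add, neg_mul,
      sub_neg_eq_add]
    ring

variable {F : (ι → ℂ) → ι → ℂ} {x : ι → ℂ} {A : (ι → ℂ) →L[ℝ] ι → ℂ}

theorem isLinearlyStable_iff (hF : HasFDerivAt F A x) (hA : realDot.IsSelfAdjoint A) :
    IsLinearlyStable F x ↔ F x = 0 ∧
      (∀ l, Module.End.HasEigenvalue (A : (ι → ℂ) →ₗ[ℝ] ι → ℂ) l → l ≤ 0) ∧
      LinearMap.ker (A : (ι → ℂ) →ₗ[ℝ] ι → ℂ) = Submodule.span ℝ {rotationMode x} := by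
  have hker := maxGenEigenspace_zero_of_isSelfAdjoint (A := (A : (ι → ℂ) →ₗ[ℝ] ι → ℂ))
    realDot_posDef hA
  refine and_congr_right fun _ =>
    ⟨?_, fun ⟨hle, hspan⟩ => ⟨A, hF, fun μ hμ => ?_, hker.trans hspan⟩⟩
  · rintro ⟨A', hA', hneg, hspan⟩
    obtain rfl := hF.unique hA'
    refine ⟨fun l hl => ?_, hker.symm.trans hspan⟩
    rcases hneg l (isComplexEigenvalue_ofReal hl) with h | h
    · exact le_of_lt h
    · exact (Complex.ofReal_eq_zero.1 h).le
  · have him := im_eq_zero_of_isSelfAdjoint realDot_posDef hA hμ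
    have hre := hle μ.re (hasEigenvalue_re_of_isSelfAdjoint realDot_posDef hA hμ)
    exact hre.lt_or_eq.imp id fun h => Complex.ext h him

theorem realDot_apply_self_nonpos (hF : HasFDerivAt F A x) (hA : realDot.IsSelfAdjoint A)
    (hstable : IsLinearlyStable F x) (v : ι → ℂ) : realDot v (A v) ≤ 0 :=
  apply_self_nonpos_of_isSelfAdjoint (A := (A : (ι → ℂ) →ₗ[ℝ] ι → ℂ)) realDot_isSymm
    realDot_posDef hA ((isLinearlyStable_iff hF hA).1 hstable).2.1 v

theorem realDot_apply_self_neg (hF : HasFDerivAt F A x) (hA : realDot.IsSelfAdjoint A)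
    (hstable : IsLinearlyStable F x) {v : ι → ℂ} (hv : v ∉ Submodule.span ℝ {rotationMode x}) :
    realDot v (A v) < 0 := by
  have hnonpos := realDot_apply_self_nonpos hF hA hstable
  refine (hnonpos v).lt_of_ne fun h => hv ?_
  rw [← ((isLinearlyStable_iff hF hA).1 hstable).2.2]
  exact apply_eq_zero_of_apply_self_eq_zero realDot_isSymm realDot_posDef hA hnonpos h

theorem isNeutrallyStable_rotationMode_comp (hF : HasFDerivAt F A x)
    (hA : realDot.IsSelfAdjoint A) (hstable : IsLinearlyStable F x) :
    IsNeutrallyStable (fun y => rotationMode (F y)) x := by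
  let J : (ι → ℂ) →ₗ[ℝ] ι → ℂ := Complex.I • LinearMap.id
  have hJA : ((Complex.I • A : (ι → ℂ) →L[ℝ] ι → ℂ) : (ι → ℂ) →ₗ[ℝ] ι → ℂ) = J ∘ₗ A :=
    LinearMap.ext fun _ => rfl
  refine ⟨by ext; simp [rotationMode, hstable.1], _, hF.const_smul Complex.I, fun μ hμ => ?_⟩
  rw [hJA] at hμ
  exact re_eq_zero_of_isComplexEigenvalue_comp realDot_isSymm realDot_posDef hA
    (realDot_apply_self_nonpos hF hA hstable) realDot_rotationMode_self hμ

end RealDot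

section CharacterSums

theorem one_sub_addChar_ne_zero {G K : Type*} [AddCommGroup G] [Field K] {ψ : AddChar G K}
    (hψ : Function.Injective ψ) {g : G} (hg : g ≠ 0) : 1 - ψ g ≠ 0 :=
  sub_ne_zero.2 fun h => hg (hψ (by rw [← h, AddChar.map_zero_eq_one]))

variable {G K : Type*} [AddCommGroup G] [Fintype G] [Field K] {ψ : AddChar G K}

theorem addChar_pow_card (g : G) : ψ g ^ Fintype.card G = 1 := by
  rw [← AddChar.map_nsmul_eq_pow, card_nsmul_eq_zero, AddChar.map_zero_eq_one]

theorem geom_sum_addChar_eq_zero (hψ : Function.Injective ψ) {g : G} (hg : g ≠ 0) :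
    ∑ n ∈ Finset.range (Fintype.card G), ψ g ^ n = 0 := by
  rw [geom_sum_eq (sub_ne_zero.1 (one_sub_addChar_ne_zero hψ hg)).symm, addChar_pow_card,
    sub_self, zero_div]

theorem card_dvd_of_forall_zpow_eq_one (hψ : Function.Injective ψ) {l : ℤ}
    (h : ∀ g, ψ g ^ l = 1) : (Fintype.card G : ℤ) ∣ l := by
  have : IsCyclic (Multiplicative G) := isCyclic_of_injective_ringHom hψ (f := ψ.toMonoidHom)
  obtain ⟨g, hg⟩ := IsCyclic.exists_ofOrder_eq_natCard (α := Multiplicative G)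
  rw [← Fintype.card_multiplicative, ← Nat.card_eq_fintype_card, ← hg,
    orderOf_dvd_iff_zpow_eq_one]
  refine hψ (a₂ := (1 : Multiplicative G)) ?_
  exact (map_zpow ψ.toMonoidHom g l).trans ((h g).trans (map_one ψ.toMonoidHom).symm)

variable [CharZero K]

theorem sum_addChar_zpow_eq_zero (hψ : Function.Injective ψ) {l : ℤ}
    (hl : ¬ (Fintype.card G : ℤ) ∣ l) : ∑ g, ψ g ^ l = 0 := by
  have hne : ψ ^ l ≠ 0 := fun h => hl <| card_dvd_of_forall_zpow_eq_one hψ fun g => by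
    rw [← AddChar.zpow_apply, h, AddChar.zero_apply]
  simpa only [AddChar.zpow_apply] using AddChar.sum_eq_zero_iff_ne_zero.2 hne

theorem sum_inv_one_sub_addChar (hψ : Function.Injective ψ) :
    ∑ g, (1 - ψ g)⁻¹ = ((Fintype.card G : K) - 1) / 2 := by
  have hsymm : ∑ g, (1 - ψ (-g))⁻¹ = ∑ g, (1 - ψ g)⁻¹ :=
    Equiv.sum_comp (Equiv.neg G) fun g => (1 - ψ g)⁻¹
  have hpair : ∑ g, ((1 - ψ g)⁻¹ + (1 - ψ (-g))⁻¹) = (Fintype.card G : K) - 1 := by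
    classical
    have hterm (g : G) : (1 - ψ g)⁻¹ + (1 - ψ (-g))⁻¹ = 1 - if g = 0 then 1 else 0 := by
      split_ifs with hg
      · simp [hg]
      · have h1 := one_sub_addChar_ne_zero hψ hg
        have h2 := one_sub_addChar_ne_zero hψ (neg_ne_zero.2 hg)
        have h3 : ψ g * ψ (-g) = 1 := by
          rw [← AddChar.map_add_eq_mul, add_neg_cancel, AddChar.map_zero_eq_one]
        field_simp
        linear_combination -h3
    simp [hterm]
  rw [Finset.sum_add_distrib, hsymm] at hpair
  linear_combination hpair / 2

theorem sum_pow_div_one_sub_addChar (hψ : Function.Injective ψ) {k : ℕ} (hk : 1 ≤ k)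
    (hkG : k ≤ Fintype.card G) :
    ∑ g, ψ g ^ k / (1 - ψ g) = k - ((Fintype.card G : K) + 1) / 2 := by
  classical
  have hstep (k : ℕ) : ∑ g, ψ g ^ (k + 1) / (1 - ψ g)
      = ∑ g, ψ g ^ k / (1 - ψ g) - (∑ g, ψ g ^ k - 1) := by
    have hterm (g : G) : ψ g ^ (k + 1) / (1 - ψ g)
        = ψ g ^ k / (1 - ψ g) - (ψ g ^ k - if g = 0 then 1 else 0) := by
      split_ifs with hg
      · simp [hg]
      · have := one_sub_addChar_ne_zero hψ hg
        field_simp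
        ring
    simp [hterm]
  induction k, hk using Nat.le_induction with
  | base =>
    rw [hstep]
    simp only [pow_zero, one_div, sum_inv_one_sub_addChar hψ, Finset.sum_const,
      Finset.card_univ, nsmul_eq_mul]
    push_cast
    ring
  | succ k hk ih =>
    have hsum : ∑ g, ψ g ^ k = 0 := by
      refine mod_cast sum_addChar_zpow_eq_zero hψ (l := k) fun hdvd => ?_
      have := Nat.le_of_dvd hk (Int.natCast_dvd_natCast.1 hdvd)
      omega
    rw [hstep, ih (by omega), hsum]
    push_cast
    ring

theorem sum_one_sub_pow_div_sq (hψ : Function.Injective ψ) {m : ℕ} (hm : m ≤ Fintype.card G) :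
    ∑ g, (1 - ψ g ^ (1 + m)) / (1 - ψ g) ^ 2 = (1 - m) * ((Fintype.card G : K) - 1 - m) / 2 := by
  induction m with
  | zero =>
    have hterm (g : G) : (1 - ψ g ^ (1 + 0)) / (1 - ψ g) ^ 2 = (1 - ψ g)⁻¹ := by
      rw [add_zero, pow_one, sq, div_self_mul_self']
    simp only [hterm, sum_inv_one_sub_addChar hψ]
    push_cast
    ring
  | succ m ih =>
    have hterm (g : G) : (1 - ψ g ^ (1 + (m + 1))) / (1 - ψ g) ^ 2
        = (1 - ψ g ^ (1 + m)) / (1 - ψ g) ^ 2 + ψ g ^ (m + 1) / (1 - ψ g) := by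
      rcases eq_or_ne (1 - ψ g) 0 with h | h
      · simp [h]
      · field_simp
        ring
    simp only [hterm, Finset.sum_add_distrib, ih (by omega),
      sum_pow_div_one_sub_addChar hψ (by omega : 1 ≤ m + 1) hm]
    push_cast
    ring

theorem sum_one_sub_zpow_div_sq (hψ : Function.Injective ψ) {m : ℤ}
    (hm : m.natAbs ≤ Fintype.card G) : ∑ g, (1 - ψ g ^ (1 + m)) / (1 - ψ g) ^ 2
      = (1 - m.natAbs) * ((Fintype.card G : K) - 1 - m.natAbs) / 2 := by
  obtain ⟨k, rfl | rfl⟩ := m.eq_nat_or_neg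
  · exact_mod_cast sum_one_sub_pow_div_sq hψ (by simpa using hm)
  · rw [Int.natAbs_neg, Int.natAbs_natCast] at hm ⊢
    have hterm (g : G) : ψ g ^ (1 + -(k : ℤ)) = ψ g ^ (1 + (Fintype.card G - k)) := by
      rw [← zpow_natCast, ← mul_one (ψ g ^ (1 + -(k : ℤ))), ← addChar_pow_card (ψ := ψ) g,
        ← zpow_natCast, ← zpow_add₀ (ψ.val_isUnit g).ne_zero]
      congr 1
      push_cast [hm]
      ring
    simp only [hterm, sum_one_sub_pow_div_sq hψ (Nat.sub_le _ k)]
    push_cast [hm]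
    ring

theorem sum_inv_inv_sub_inv_addChar (hψ : Function.Injective ψ) (g : G) :
    ∑ h, ((ψ g)⁻¹ - (ψ h)⁻¹)⁻¹ = ψ g * (((Fintype.card G : K) - 1) / 2) := by
  have hterm (h : G) : ((ψ g)⁻¹ - (ψ h)⁻¹)⁻¹ = ψ g * (1 - ψ (g - h))⁻¹ := by
    have := (ψ.val_isUnit g).ne_zero
    rw [AddChar.map_sub_eq_div, ← inv_inv (ψ g), ← mul_inv, inv_inv]
    field_simp
  simp only [hterm, ← Finset.mul_sum]
  rw [← sum_inv_one_sub_addChar hψ]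
  exact congr_arg _ (Equiv.sum_comp (Equiv.subLeft g) fun k => (1 - ψ k)⁻¹)

theorem sum_zpow_sub_zpow_div_inv_sub_inv_sq (hψ : Function.Injective ψ) {m : ℤ}
    (hm : m.natAbs ≤ Fintype.card G) (g : G) :
    ∑ h, (ψ g ^ (-(1 + m)) - ψ h ^ (-(1 + m))) / ((ψ g)⁻¹ - (ψ h)⁻¹) ^ 2
      = ψ g ^ (1 - m) * ((1 - m.natAbs) * ((Fintype.card G : K) - 1 - m.natAbs) / 2) := by
  have hterm (h : G) : (ψ g ^ (-(1 + m)) - ψ h ^ (-(1 + m))) / ((ψ g)⁻¹ - (ψ h)⁻¹) ^ 2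
      = ψ g ^ (1 - m) * ((1 - ψ (g - h) ^ (1 + m)) / (1 - ψ (g - h)) ^ 2) := by
    have hg := (ψ.val_isUnit g).ne_zero
    have hh := (ψ.val_isUnit h).ne_zero
    have hbase : (ψ g)⁻¹ - (ψ h)⁻¹ = (ψ g)⁻¹ * (1 - ψ (g - h)) := by
      rw [AddChar.map_sub_eq_div]
      field_simp
    have hnum : ψ g ^ (-(1 + m)) - ψ h ^ (-(1 + m))
        = ψ g ^ (-(1 + m)) * (1 - ψ (g - h) ^ (1 + m)) := by
      rw [AddChar.map_sub_eq_div, div_zpow, zpow_neg, zpow_neg]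
      field_simp
    have hpow : ψ g ^ (1 - m) = ψ g ^ (-(1 + m)) * ψ g ^ 2 := by
      rw [← zpow_natCast, ← zpow_add₀ hg]
      congr 1
      push_cast
      ring
    rw [hbase, hnum, hpow, mul_pow, mul_div_mul_comm, inv_pow, div_inv_eq_mul]
  simp only [hterm, ← Finset.mul_sum]
  rw [← sum_one_sub_zpow_div_sq hψ hm]
  exact congr_arg _ (Equiv.sum_comp (Equiv.subLeft g) fun k => (1 - ψ k ^ (1 + m)) / (1 - ψ k) ^ 2)

end CharacterSums

section Rotation

variable {ι : Type*} [Fintype ι] [DecidableEq ι] {f : ℝ → ℝ} {c ω : ℝ} {x : ι → ℂ}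

theorem rotatingVortexField_eq_rotationMode :
    rotatingVortexField f c ω x = rotationMode (aggregationField f c ω x) := by
  ext j
  simp only [rotatingVortexField, vortexField, aggregationField, rotationMode]
  push_cast
  ring

theorem vortexField_rotate {u : ℂ} (hu : ‖u‖ = 1) (j : ι) :
    vortexField f c (fun k => u * x k) j = u * vortexField f c x j := by
  simp only [vortexField, ← mul_sub, norm_mul, hu, one_mul, mul_div_assoc, ← Finset.mul_sum]
  ring

theorem isVortexSolution_rotating_iff :
    IsVortexSolution f c (fun t j => Complex.exp (Complex.I * ω * t) * x j) ↔
      aggregationField f c ω x = 0 := by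
  have hderiv (t : ℝ) (j : ι) : HasDerivAt (fun s : ℝ => Complex.exp (Complex.I * ω * s) * x j)
      (Complex.exp (Complex.I * ω * t) * (Complex.I * ω * x j)) t := by
    have hlin : HasDerivAt (fun s : ℝ => Complex.I * ω * s) (Complex.I * ω) t := by
      simpa using (Complex.ofRealCLM.hasDerivAt (x := t)).const_mul (Complex.I * ω)
    simpa [mul_assoc] using hlin.cexp.mul_const (x j)
  have hfield (t : ℝ) (j : ι) :
      vortexField f c (fun k => Complex.exp (Complex.I * ω * t) * x k) j
        - Complex.exp (Complex.I * ω * t) * (Complex.I * ω * x j)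
      = Complex.exp (Complex.I * ω * t) * (Complex.I * aggregationField f c ω x j) := by
    have hnorm : ‖Complex.exp (Complex.I * ω * t)‖ = 1 := by simp [Complex.norm_exp]
    have hrot : vortexField f c x j - Complex.I * ω * x j
        = Complex.I * aggregationField f c ω x j :=
      congr_fun rotatingVortexField_eq_rotationMode j
    rw [vortexField_rotate hnorm, ← hrot, mul_sub]
  have hsol (t : ℝ) (j : ι) : HasDerivAt (fun s : ℝ => Complex.exp (Complex.I * ω * s) * x j)
      (vortexField f c (fun k => Complex.exp (Complex.I * ω * t) * x k) j) t ↔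
      aggregationField f c ω x j = 0 := by
    have hzero : aggregationField f c ω x j = 0 ↔
        Complex.exp (Complex.I * ω * t) * (Complex.I * aggregationField f c ω x j) = 0 := by
      simp [Complex.exp_ne_zero]
    rw [hzero, ← hfield, sub_eq_zero]
    exact ⟨fun h => h.unique (hderiv t j), fun h => h ▸ hderiv t j⟩
  simp only [IsVortexSolution, hsol, funext_iff, Pi.zero_apply, forall_const]

end Rotation

section Linearization

variable {f : ℝ → ℝ} {c ω : ℝ}

/-- The derivative at `x` of the radial field `y ↦ (f ‖y‖ - ω) y` on the plane. The formula is also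
right at `x = 0`, where `x / ‖x‖ = 0`. -/
noncomputable def radialDeriv (f : ℝ → ℝ) (ω : ℝ) (x : ℂ) : ℂ →L[ℝ] ℂ :=
  ((f ‖x‖ - ω : ℝ) : ℂ) • ContinuousLinearMap.id ℝ ℂ
    + ((deriv f ‖x‖ * ‖x‖ / 2 : ℝ) : ℂ) •
      (ContinuousLinearMap.id ℝ ℂ + (x / ‖x‖) ^ 2 • (Complex.conjCLE : ℂ →L[ℝ] ℂ))

theorem radialDeriv_apply (x h : ℂ) : radialDeriv f ω x h =
    (f ‖x‖ - ω : ℝ) * h + (deriv f ‖x‖ * ‖x‖ / 2 : ℝ) * (h + (x / ‖x‖) ^ 2 * conj h) := by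
  simp [radialDeriv, mul_add]

theorem hasFDerivAt_norm {E : Type*} [NormedAddCommGroup E] [InnerProductSpace ℝ E] {x : E}
    (hx : x ≠ 0) : HasFDerivAt (fun y : E => ‖y‖) (‖x‖⁻¹ • innerSL ℝ x) x := by
  have hsqrt := (hasStrictFDerivAt_norm_sq x).hasFDerivAt.sqrt (by simpa using hx)
  simp only [Real.sqrt_sq (norm_nonneg _)] at hsqrt
  refine hsqrt.congr_fderiv (ContinuousLinearMap.ext fun y => ?_)
  have := norm_ne_zero_iff.2 hx
  simp only [one_div, mul_inv_rev, smul_apply, coe_innerSL_apply, nsmul_eq_mul, Nat.cast_ofNat,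
    smul_eq_mul]
  field_simp

theorem hasFDerivAt_radial_of_ne_zero {x : ℂ} (hx : x ≠ 0) (hf : DifferentiableAt ℝ f ‖x‖) :
    HasFDerivAt (fun y : ℂ => ((f ‖y‖ - ω : ℝ) : ℂ) * y) (radialDeriv f ω x) x := by
  have hscalar : HasFDerivAt (fun y : ℂ => ((f ‖y‖ - ω : ℝ) : ℂ))
      (Complex.ofRealCLM.comp (deriv f ‖x‖ • ‖x‖⁻¹ • innerSL ℝ x)) x :=
    Complex.ofRealCLM.hasFDerivAt.comp x
      ((hf.hasDerivAt.comp_hasFDerivAt x (hasFDerivAt_norm hx)).sub_const ω)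
  refine (hscalar.mul (hasFDerivAt_id (𝕜 := ℝ) x)).congr_fderiv
    (ContinuousLinearMap.ext fun h => ?_)
  have hnorm : (‖x‖ : ℂ) ≠ 0 := by exact_mod_cast norm_ne_zero_iff.2 hx
  have hinner : ((inner ℝ x h : ℝ) : ℂ) = (h * conj x + conj h * x) / 2 := by
    rw [Complex.inner, Complex.re_eq_add_conj, map_mul, Complex.conj_conj]
  have hmul : x * conj x = (‖x‖ : ℂ) ^ 2 := by rw [Complex.mul_conj']
  rw [radialDeriv_apply]
  simp only [add_apply, smul_apply, ContinuousLinearMap.comp_apply, Complex.ofRealCLM_apply,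
    innerSL_apply_apply, smul_eq_mul, ContinuousLinearMap.id_apply, id]
  push_cast
  rw [hinner]
  field_simp
  linear_combination (deriv f ‖x‖ * h : ℂ) * hmul

theorem hasFDerivAt_radial_zero (hf : ContinuousWithinAt f (Set.Ici 0) 0) :
    HasFDerivAt (fun y : ℂ => ((f ‖y‖ - ω : ℝ) : ℂ) * y) (radialDeriv f ω 0) 0 := by
  have hnorm : Filter.Tendsto (fun y : ℂ => ‖y‖) (nhds 0) (nhdsWithin 0 (Set.Ici 0)) :=
    tendsto_nhdsWithin_iff.2
      ⟨tendsto_norm_zero, Filter.Eventually.of_forall fun y => norm_nonneg y⟩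
  have hlim : Filter.Tendsto (fun y : ℂ => ((f ‖y‖ - f 0 : ℝ) : ℂ)) (nhds 0) (nhds 0) := by
    have := (Complex.continuous_ofReal.tendsto _).comp ((hf.tendsto.comp hnorm).sub_const (f 0))
    simpa only [sub_self, Complex.ofReal_zero, Function.comp_def] using this
  have hlittle : (fun y : ℂ => ((f ‖y‖ - f 0 : ℝ) : ℂ) * y) =o[nhds 0] fun y : ℂ => (1 : ℂ) * y :=
    ((Asymptotics.isLittleO_one_iff ℂ).2 hlim).mul_isBigO (Asymptotics.isBigO_refl _ _)
  rw [hasFDerivAt_iff_isLittleO_nhds_zero]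
  refine hlittle.congr (fun y => ?_) one_mul
  simp only [radialDeriv_apply, zero_add, norm_zero, mul_zero, zero_div, Complex.ofReal_zero,
    zero_mul]
  push_cast
  ring

theorem div_norm_sq_eq_inv_conj (x : ℂ) : x / ((‖x‖ ^ 2 : ℝ) : ℂ) = (conj x)⁻¹ := by
  rcases eq_or_ne x 0 with rfl | hx
  · simp
  · rw [Complex.ofReal_pow, ← Complex.mul_conj', div_mul_cancel_left₀ hx]

theorem hasFDerivAt_div_norm_sq {x : ℂ} (hx : x ≠ 0) :
    HasFDerivAt (fun y : ℂ => y / ((‖y‖ ^ 2 : ℝ) : ℂ))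
      (-((conj x ^ 2)⁻¹ • (Complex.conjCLE : ℂ →L[ℝ] ℂ))) x := by
  have hconj : conj x ≠ 0 := (map_ne_zero _).2 hx
  have hinv := ((hasDerivAt_inv hconj).hasFDerivAt.restrictScalars ℝ).comp x
    (Complex.conjCLE : ℂ →L[ℝ] ℂ).hasFDerivAt
  simp only [div_norm_sq_eq_inv_conj]
  refine hinv.congr_fderiv (ContinuousLinearMap.ext fun y => ?_)
  simp [mul_comm]

variable {ι : Type*} [Fintype ι]

/-- The linearization at `x` of the aggregation field. -/
noncomputable def aggregationDeriv (f : ℝ → ℝ) (c ω : ℝ) (x : ι → ℂ) :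
    (ι → ℂ) →L[ℝ] ι → ℂ :=
  ContinuousLinearMap.pi fun j =>
    (radialDeriv f ω (x j)).comp (ContinuousLinearMap.proj j)
      - (c : ℂ) • ∑ k, (conj (x j - x k) ^ 2)⁻¹ • (Complex.conjCLE : ℂ →L[ℝ] ℂ).comp
        (ContinuousLinearMap.proj (R := ℝ) (φ := fun _ : ι => ℂ) j - ContinuousLinearMap.proj k)

theorem aggregationDeriv_apply (x h : ι → ℂ) (j : ι) : aggregationDeriv f c ω x h j =
    radialDeriv f ω (x j) (h j)
      - c * ∑ k, (conj (h j) - conj (h k)) / conj (x j - x k) ^ 2 := by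
  simp [aggregationDeriv, div_eq_inv_mul]

theorem aggregationField_apply [DecidableEq ι] (x : ι → ℂ) (j : ι) : aggregationField f c ω x j =
    (f ‖x j‖ - ω : ℝ) * x j + c * ∑ k, (conj (x j - x k))⁻¹ := by
  rw [← Finset.sum_erase Finset.univ (a := j) (by simp)]
  simp only [aggregationField, div_norm_sq_eq_inv_conj]

theorem aggregationDeriv_rotationMode [DecidableEq ι] (x : ι → ℂ) :
    aggregationDeriv f c ω x (rotationMode x) = rotationMode (aggregationField f c ω x) := by
  ext j
  have htangent : Complex.I * x j + (x j / ‖x j‖) ^ 2 * conj (Complex.I * x j) = 0 := by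
    rcases eq_or_ne (x j) 0 with h | h
    · simp [h]
    · have hnorm : (‖x j‖ : ℂ) ≠ 0 := by exact_mod_cast norm_ne_zero_iff.2 h
      rw [map_mul, Complex.conj_I]
      field_simp
      linear_combination -Complex.I * x j * Complex.mul_conj' (x j)
  have hterm (k : ι) : (conj (Complex.I * x j) - conj (Complex.I * x k)) / conj (x j - x k) ^ 2
      = -Complex.I * (conj (x j - x k))⁻¹ := by
    rw [← map_sub, ← mul_sub, map_mul, Complex.conj_I, mul_div_assoc, sq, div_self_mul_self']
  simp only [rotationMode, aggregationDeriv_apply, radialDeriv_apply, aggregationField_apply,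
    htangent, hterm, ← Finset.mul_sum]
  ring

theorem hasFDerivAt_aggregationField [DecidableEq ι] {x : ι → ℂ} (hx : Function.Injective x)
    (hf0 : ContinuousWithinAt f (Set.Ici 0) 0)
    (hf : ∀ j, x j ≠ 0 → DifferentiableAt ℝ f ‖x j‖) :
    HasFDerivAt (aggregationField f c ω) (aggregationDeriv f c ω x) x := by
  refine hasFDerivAt_pi.2 fun j => ?_
  have hradial : HasFDerivAt (fun y : ℂ => ((f ‖y‖ - ω : ℝ) : ℂ) * y)
      (radialDeriv f ω (x j)) (x j) := by
    rcases eq_or_ne (x j) 0 with h0 | h0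
    · rw [h0]
      exact hasFDerivAt_radial_zero hf0
    · exact hasFDerivAt_radial_of_ne_zero h0 (hf j h0)
  have hinteraction (k : ι) (hk : k ∈ Finset.univ.erase j) :
      HasFDerivAt (fun y : ι → ℂ => (y j - y k) / ((‖y j - y k‖ ^ 2 : ℝ) : ℂ))
        ((-((conj (x j - x k) ^ 2)⁻¹ • (Complex.conjCLE : ℂ →L[ℝ] ℂ))).comp
          (ContinuousLinearMap.proj (R := ℝ) (φ := fun _ : ι => ℂ) j
            - ContinuousLinearMap.proj k)) x :=
    HasFDerivAt.comp x
      (hasFDerivAt_div_norm_sq (sub_ne_zero.2 (hx.ne (Finset.ne_of_mem_erase hk).symm)))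
      ((hasFDerivAt_apply j x).sub (hasFDerivAt_apply k x))
  refine ((hradial.comp x (hasFDerivAt_apply j x)).add
    ((HasFDerivAt.fun_sum hinteraction).const_smul (c : ℂ))).congr_fderiv ?_
  rw [← Finset.sum_erase Finset.univ (a := j) (by ext1; simp)]
  simp only [ContinuousLinearMap.neg_comp, ContinuousLinearMap.smul_comp, Finset.sum_neg_distrib,
    smul_neg, sub_eq_add_neg]

theorem sum_mul_sum_sub_mul_comm {R : Type*} [CommRing R] {κ : ι → ι → R}
    (hκ : ∀ j k, κ j k = κ k j) (a b : ι → R) :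
    ∑ j, a j * ∑ k, (b j - b k) * κ j k = ∑ j, b j * ∑ k, (a j - a k) * κ j k := by
  have hswap : ∑ j, ∑ k, a j * b k * κ j k = ∑ j, ∑ k, b j * a k * κ j k := by
    rw [Finset.sum_comm]
    exact Finset.sum_congr rfl fun j _ => Finset.sum_congr rfl fun k _ => by rw [hκ]; ring
  simp only [sub_mul, Finset.sum_sub_distrib, mul_sub, Finset.mul_sum, ← mul_assoc, hswap]
  simp only [mul_comm]

theorem aggregationDeriv_isSelfAdjoint (x : ι → ℂ) :
    realDot.IsSelfAdjoint (aggregationDeriv f c ω x) := by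
  intro a b
  have hradial (j : ι) : (conj (b j) * radialDeriv f ω (x j) (a j)).re
      = (conj (a j) * radialDeriv f ω (x j) (b j)).re := by
    simp only [radialDeriv_apply, Complex.ofReal_sub, Complex.ofReal_div, Complex.ofReal_mul,
      Complex.ofReal_ofNat, Complex.mul_re, Complex.conj_re, Complex.add_re, Complex.sub_re,
      Complex.ofReal_re, Complex.sub_im, Complex.ofReal_im, sub_self, zero_mul, sub_zero,
      Complex.div_ofNat_re, mul_zero, Complex.conj_im, mul_neg, sub_neg_eq_add,
      Complex.div_ofNat_im, Complex.mul_im, add_zero, zero_div, Complex.add_im, neg_mul]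
    ring
  have hinteraction := congr_arg Complex.re <| sum_mul_sum_sub_mul_comm
    (κ := fun j k => (conj (x j - x k) ^ 2)⁻¹) (fun j k => by rw [← neg_sub, map_neg, neg_sq])
    (fun j => conj (b j)) fun j => conj (a j)
  rw [realDot_isSymm.eq]
  simp only [realDot_apply, aggregationDeriv_apply, div_eq_mul_inv, mul_sub, Complex.sub_re,
    Finset.sum_sub_distrib, hradial, mul_left_comm _ (c : ℂ), Complex.re_ofReal_mul,
    ← Finset.mul_sum, ← Complex.re_sum, hinteraction]

end Linearization

section Ring

variable {N : ℕ} {R : ℝ}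

theorem ringPlusCenter_none : ringPlusCenter N R none = 0 := rfl

variable [NeZero N]

/-- The character `j ↦ e^{2πij/N}` of `Fin N`, whose values are the vertices of the unit ring. -/
noncomputable def ringChar (N : ℕ) [NeZero N] : AddChar (Fin N) ℂ :=
  ZMod.stdAddChar.compAddMonoidHom (ZMod.finEquiv N : Fin N →+ ZMod N)

theorem ringChar_injective : Function.Injective (ringChar N) :=
  ZMod.injective_stdAddChar.comp (ZMod.finEquiv N).injective

theorem ringPlusCenter_some (j : Fin N) : ringPlusCenter N R (some j) = R * ringChar N j := by
  have hcast : ((j : ℕ) : ZMod N) = ZMod.finEquiv N j := by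
    obtain ⟨n, rfl⟩ := Nat.exists_eq_succ_of_ne_zero (NeZero.ne N)
    exact Fin.cast_val_eq_self j
  have hchar := ZMod.stdAddChar_coe (N := N) (j : ℕ)
  rw [Int.cast_natCast, Int.cast_natCast, hcast] at hchar
  exact congr_arg ((R : ℂ) * ·) hchar.symm

theorem norm_ringChar (j : Fin N) : ‖ringChar N j‖ = 1 := AddChar.norm_apply _ j

theorem conj_ringChar (j : Fin N) : conj (ringChar N j) = (ringChar N j)⁻¹ :=
  (Complex.inv_eq_conj (norm_ringChar j)).symm

theorem ringPlusCenter_injective (hR : R ≠ 0) : Function.Injective (ringPlusCenter N R) := by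
  have hRC : (R : ℂ) ≠ 0 := Complex.ofReal_ne_zero.2 hR
  have hsome (j : Fin N) : ringPlusCenter N R (some j) ≠ 0 := by
    rw [ringPlusCenter_some]
    exact mul_ne_zero hRC ((ringChar N).val_isUnit j).ne_zero
  rintro (_ | j) (_ | k) h
  · rfl
  · exact absurd h.symm (hsome k)
  · exact absurd h (hsome j)
  · rw [ringPlusCenter_some, ringPlusCenter_some] at h
    exact congr_arg some (ringChar_injective (mul_left_cancel₀ hRC h))

theorem norm_ringPlusCenter_some (hR : 0 < R) (j : Fin N) : ‖ringPlusCenter N R (some j)‖ = R := by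
  rw [ringPlusCenter_some, norm_mul, norm_ringChar, mul_one, Complex.norm_of_nonneg hR.le]

end Ring

section Equilibrium

variable {N : ℕ} [NeZero N] {f : ℝ → ℝ} {c R ω : ℝ}

/-- The angular velocity at which the ring with a central vortex rotates rigidly. -/
noncomputable def angularVelocity (f : ℝ → ℝ) (c R : ℝ) (N : ℕ) : ℝ :=
  f R + c / (2 * R ^ 2) * (N + 1)

theorem sum_ringChar_zpow_eq_zero {l : ℤ} (hl : ¬ (N : ℤ) ∣ l) : ∑ j, ringChar N j ^ l = 0 :=
  sum_addChar_zpow_eq_zero ringChar_injective (by rwa [Fintype.card_fin])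

theorem sum_ringChar_eq_zero (hN : 2 ≤ N) : ∑ j, ringChar N j = 0 := by
  simpa using sum_ringChar_zpow_eq_zero (l := 1) fun h => by
    have := Int.le_of_dvd one_pos h
    omega

theorem aggregationField_ringPlusCenter (hN : 2 ≤ N) (hR : 0 < R) :
    aggregationField f c ω (ringPlusCenter N R)
      = (angularVelocity f c R N - ω) • ringPlusCenter N R := by
  have hRC : (R : ℂ) ≠ 0 := Complex.ofReal_ne_zero.2 hR.ne'
  have hinv (z : ℂ) : (conj ((R : ℂ) * z))⁻¹ = (R : ℂ)⁻¹ * (conj z)⁻¹ := by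
    rw [map_mul, Complex.conj_ofReal, mul_inv]
  ext (_ | j)
  · simp only [aggregationField_apply, Fintype.sum_option, ringPlusCenter_some, ringPlusCenter_none,
      zero_sub, map_neg, inv_neg, hinv, conj_ringChar, inv_inv, Finset.sum_neg_distrib,
      ← Finset.mul_sum, sum_ringChar_eq_zero hN, Pi.smul_apply, smul_zero, map_zero,
      inv_zero, mul_zero, neg_zero, add_zero]
  · have hsum : ∑ k, (conj ((R : ℂ) * ringChar N j - R * ringChar N k))⁻¹
        = (R : ℂ)⁻¹ * (ringChar N j * ((N - 1) / 2)) := by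
      simp only [← mul_sub, hinv, map_sub, conj_ringChar, ← Finset.mul_sum,
        sum_inv_inv_sub_inv_addChar ringChar_injective, Fintype.card_fin]
    rw [aggregationField_apply, norm_ringPlusCenter_some hR, Fintype.sum_option, Pi.smul_apply]
    simp only [ringPlusCenter_some, ringPlusCenter_none, sub_zero, hinv, conj_ringChar, inv_inv,
      hsum, angularVelocity, Complex.real_smul]
    push_cast
    field_simp
    ring

theorem aggregationField_ringPlusCenter_eq_zero_iff (hN : 2 ≤ N) (hR : 0 < R) :
    aggregationField f c ω (ringPlusCenter N R) = 0 ↔ ω = angularVelocity f c R N := by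
  have hne : ringPlusCenter N R ≠ 0 := fun h => by
    simpa [h, hR.ne] using norm_ringPlusCenter_some (N := N) hR 0
  rw [aggregationField_ringPlusCenter hN hR, smul_eq_zero_iff_left hne, sub_eq_zero, eq_comm]

end Equilibrium

section Coefficients

variable {f : ℝ → ℝ} {c R : ℝ} {N : ℕ}

/-- The coefficient with which a ring mode of the linearization acts on itself. -/
noncomputable def modeDiag (f : ℝ → ℝ) (c R : ℝ) (N : ℕ) : ℝ :=
  deriv f R * R / 2 - c * (N + 1) / (2 * R ^ 2)

/-- The coefficient with which the linearization couples the ring modes `1 + m` and `1 - m`. -/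
noncomputable def modeCoupling (f : ℝ → ℝ) (c R : ℝ) (N m : ℕ) : ℝ :=
  deriv f R * R / 2 - c / R ^ 2 * ((1 - m) * (N - 1 - m) / 2 + 1)

theorem modeDiag_add_modeCoupling (m : ℕ) :
    modeDiag f c R N + modeCoupling f c R N m = lambdaPlusStar f c R N m := by
  rw [modeDiag, modeCoupling, lambdaPlusStar, lambdaPlus]
  ring

theorem modeDiag_sub_modeCoupling (m : ℕ) :
    modeDiag f c R N - modeCoupling f c R N m = -(c / R ^ 2 * (m * (N - m) / 2)) := by
  rw [modeDiag, modeCoupling]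
  ring

theorem M0_eq : M0 f c R N = !![modeDiag f c R N, modeCoupling f c R N 1, c / R ^ 2;
    modeCoupling f c R N 1, modeDiag f c R N, 0;
    c / R ^ 2 * N, 0, f 0 - angularVelocity f c R N] := by
  have hcoupling : modeCoupling f c R N 1 = deriv f R * (R / 2) - c / R ^ 2 := by
    rw [modeCoupling]
    push_cast
    ring
  rw [M0, hcoupling, modeDiag, angularVelocity, mul_div_assoc (deriv f R), mul_div_right_comm c,
    sub_sub, mul_div_right_comm c]

theorem lambdaPlusStar_le_half (hc : 0 ≤ c) (m : ℕ) :
    lambdaPlusStar f c R N m ≤ lambdaPlusStar f c R N (N / 2) := by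
  have hmax : (m : ℝ) * (N - m) ≤ (N / 2 : ℕ) * (N - (N / 2 : ℕ)) := by
    have hroots : 0 ≤ ((m : ℤ) - (N / 2 : ℕ)) * (m - (N - (N / 2 : ℕ))) := by
      rcases le_or_gt m (N / 2) with h | h
      · exact mul_nonneg_of_nonpos_of_nonpos (by omega) (by omega)
      · exact mul_nonneg (by omega) (by omega)
    have hroots' : (0 : ℝ) ≤ ((m : ℝ) - (N / 2 : ℕ)) * (m - (N - (N / 2 : ℕ))) := by
      exact_mod_cast hroots
    linarith
  have hfactor : 0 ≤ c / (2 * R ^ 2) := by positivity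
  rw [lambdaPlusStar, lambdaPlusStar, lambdaPlus, lambdaPlus]
  refine sub_le_sub_right (add_le_add le_rfl (mul_le_mul_of_nonneg_left ?_ hfactor)) _
  linarith

/-- The inner product `N u₀ v₀ + N u₁ v₁ + u₂ v₂`, for which `M0` is self-adjoint: the two ring
modes coupled to the central vortex have squared norm `N`. -/
noncomputable def centralForm (N : ℕ) : LinearMap.BilinForm ℝ (Fin 3 → ℝ) :=
  Matrix.toBilin' (Matrix.diagonal ![(N : ℝ), N, 1])

theorem centralForm_apply (u v : Fin 3 → ℝ) :
    centralForm N u v = N * (u 0 * v 0) + N * (u 1 * v 1) + u 2 * v 2 := by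
  simp only [centralForm, Matrix.toBilin'_apply', dotProduct, Matrix.mulVec_diagonal,
    Fin.sum_univ_three, Matrix.cons_val, one_mul]
  ring

theorem centralForm_posDef [NeZero N] : (centralForm N).toQuadraticMap.PosDef := by
  intro u hu
  have hN : (0 : ℝ) < N := Nat.cast_pos.2 (NeZero.pos N)
  change 0 < centralForm N u u
  rw [centralForm_apply]
  obtain ⟨i, hi⟩ := Function.ne_iff.1 hu
  have hi' := mul_self_pos.2 hi
  have h0 := mul_nonneg hN.le (mul_self_nonneg (u 0))
  have h1 := mul_nonneg hN.le (mul_self_nonneg (u 1))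
  have h2 := mul_self_nonneg (u 2)
  fin_cases i
  · exact add_pos_of_pos_of_nonneg (add_pos_of_pos_of_nonneg (mul_pos hN hi') h1) h2
  · exact add_pos_of_pos_of_nonneg (add_pos_of_nonneg_of_pos h0 (mul_pos hN hi')) h2
  · exact add_pos_of_nonneg_of_pos (add_nonneg h0 h1) hi'

theorem M0_mulVec (u : Fin 3 → ℝ) : (M0 f c R N).mulVec u =
    ![modeDiag f c R N * u 0 + modeCoupling f c R N 1 * u 1 + c / R ^ 2 * u 2,
      modeCoupling f c R N 1 * u 0 + modeDiag f c R N * u 1,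
      c / R ^ 2 * N * u 0 + (f 0 - angularVelocity f c R N) * u 2] := by
  ext i
  fin_cases i <;> simp [M0_eq, Matrix.mulVec, dotProduct, Fin.sum_univ_three]

theorem M0_isSelfAdjoint : (centralForm N).IsSelfAdjoint (Matrix.toLin' (M0 f c R N)) := by
  intro u v
  simp only [centralForm_apply, Matrix.toLin'_apply, M0_mulVec, Matrix.cons_val]
  ring

end Coefficients

section Fourier

variable {N : ℕ} [NeZero N]

theorem conj_sum_ringChar_zpow (l : ℤ) :
    conj (∑ j, ringChar N j ^ l) = ∑ j, ringChar N j ^ l := by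
  rw [map_sum, ← Equiv.sum_comp (Equiv.neg (Fin N))]
  simp [AddChar.map_neg_eq_inv, conj_ringChar]

/-- The Fourier coefficient `∑ⱼ e^{-2πijn/N} xⱼ` of the ring part of a configuration. It is indexed
by `n : ℤ`, of which only the residue mod `N` matters. -/
noncomputable def ringCoeff (x : Option (Fin N) → ℂ) (n : ℤ) : ℂ :=
  ∑ j, ringChar N j ^ (-n) * x (some j)

theorem conj_ringCoeff (x : Option (Fin N) → ℂ) (n : ℤ) :
    conj (ringCoeff x n) = ∑ j, ringChar N j ^ n * conj (x (some j)) := by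
  simp [ringCoeff, conj_ringChar]

theorem ringCoeff_smul (l : ℝ) (x : Option (Fin N) → ℂ) (n : ℤ) :
    ringCoeff (l • x) n = l * ringCoeff x n := by
  simp only [ringCoeff, Pi.smul_apply, Complex.real_smul, mul_left_comm _ (l : ℂ), Finset.mul_sum]

theorem sum_ringChar_pow_mul_ringCoeff (x : Option (Fin N) → ℂ) (j : Fin N) :
    ∑ n ∈ Finset.range N, ringChar N j ^ n * ringCoeff x n = N * x (some j) := by
  have hgeom (k : Fin N) : (∑ n ∈ Finset.range N, ringChar N (j - k) ^ n) * x (some k)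
      = if k = j then N * x (some j) else 0 := by
    split_ifs with h
    · simp [h]
    · have := geom_sum_addChar_eq_zero ringChar_injective (sub_ne_zero.2 (Ne.symm h))
      rw [Fintype.card_fin] at this
      rw [this, zero_mul]
  have hterm (n : ℕ) (k : Fin N) :
      ringChar N j ^ n * (ringChar N k ^ (-(n : ℤ)) * x (some k))
        = ringChar N (j - k) ^ n * x (some k) := by
    rw [AddChar.map_sub_eq_div, div_pow, zpow_neg, zpow_natCast, div_eq_mul_inv, mul_assoc]
  simp only [ringCoeff, Finset.mul_sum, hterm]
  rw [Finset.sum_comm]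
  simp [← Finset.sum_mul, hgeom]

/-- The configuration with ring part `a e^{2πij(1 + m)/N} + b e^{2πij(1 - m)/N}` and the central
vortex at `h`. -/
noncomputable def ringMode (N : ℕ) [NeZero N] (m : ℤ) (a b h : ℂ) : Option (Fin N) → ℂ
  | some j => a * ringChar N j ^ (1 + m) + b * ringChar N j ^ (1 - m)
  | none => h

theorem realDot_ringMode (m : ℤ) (a b h : ℂ) (y : Option (Fin N) → ℂ) :
    realDot (ringMode N m a b h) y = (conj a * ringCoeff y (1 + m)
      + conj b * ringCoeff y (1 - m) + conj h * y none).re := by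
  have hterm (j : Fin N) :
      conj (a * ringChar N j ^ (1 + m) + b * ringChar N j ^ (1 - m)) * y (some j) =
        conj a * (ringChar N j ^ (-(1 + m)) * y (some j))
        + conj b * (ringChar N j ^ (-(1 - m)) * y (some j)) := by
    simp only [map_add, map_mul, map_zpow₀, conj_ringChar, inv_zpow', add_mul, mul_assoc]
  simp only [realDot_apply, Fintype.sum_option, ringMode, hterm, ← Complex.re_sum,
    Finset.sum_add_distrib, ← Finset.mul_sum, ringCoeff]
  rw [add_comm]

theorem ringCoeff_ringMode (m : ℤ) (a b h : ℂ) (n : ℤ) : ringCoeff (ringMode N m a b h) n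
    = a * ∑ j, ringChar N j ^ (1 + m - n) + b * ∑ j, ringChar N j ^ (1 - m - n) := by
  have hterm (j : Fin N) : ringChar N j ^ (-n)
      * (a * ringChar N j ^ (1 + m) + b * ringChar N j ^ (1 - m))
        = a * ringChar N j ^ (1 + m - n) + b * ringChar N j ^ (1 - m - n) := by
    simp only [sub_eq_add_neg (_ + m) n, sub_eq_add_neg (_ - m) n,
      zpow_add₀ ((ringChar N).val_isUnit j).ne_zero _ (-n)]
    ring
  simp only [ringCoeff, ringMode, hterm, Finset.sum_add_distrib, Finset.mul_sum]

end Fourier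

section RingDeriv

variable {N : ℕ} {f : ℝ → ℝ} {c R : ℝ}

/-- The linearization at the ring with a central vortex of the aggregation field, in the frame in
which that configuration is an equilibrium. -/
noncomputable def ringDeriv (f : ℝ → ℝ) (c R : ℝ) (N : ℕ) :
    (Option (Fin N) → ℂ) →L[ℝ] Option (Fin N) → ℂ :=
  aggregationDeriv f c (angularVelocity f c R N) (ringPlusCenter N R)

theorem ringDeriv_isSelfAdjoint : realDot.IsSelfAdjoint (ringDeriv f c R N) :=
  aggregationDeriv_isSelfAdjoint _

variable [NeZero N]

theorem hasFDerivAt_aggregationField_ringPlusCenter (hR : 0 < R)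
    (hf0 : ContinuousWithinAt f (Set.Ici 0) 0) (hfR : DifferentiableAt ℝ f R) :
    HasFDerivAt (aggregationField f c (angularVelocity f c R N)) (ringDeriv f c R N)
      (ringPlusCenter N R) := by
  refine hasFDerivAt_aggregationField (ringPlusCenter_injective hR.ne') hf0 ?_
  rintro (_ | j) h
  · exact absurd ringPlusCenter_none h
  · rwa [norm_ringPlusCenter_some hR]

theorem ringDeriv_rotationMode (hN : 2 ≤ N) (hR : 0 < R) :
    ringDeriv f c R N (rotationMode (ringPlusCenter N R)) = 0 := by
  rw [ringDeriv, aggregationDeriv_rotationMode,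
    (aggregationField_ringPlusCenter_eq_zero_iff hN hR).2 rfl]
  exact funext fun _ => mul_zero _

theorem ringDeriv_apply_none (x : Option (Fin N) → ℂ) :
    ringDeriv f c R N x none = (f 0 - angularVelocity f c R N : ℝ) * x none
      + (c / R ^ 2 : ℝ) * (conj (ringCoeff x 2) - conj (x none) * ∑ j, ringChar N j ^ (2 : ℤ)) := by
  have hterm (k : Fin N) : (conj (x none) - conj (x (some k))) / conj (0 - R * ringChar N k) ^ 2
      = -((R : ℂ) ^ 2)⁻¹ * (ringChar N k ^ (2 : ℤ) * conj (x (some k))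
        - conj (x none) * ringChar N k ^ (2 : ℤ)) := by
    have hE := ((ringChar N).val_isUnit k).ne_zero
    rw [zero_sub, map_neg, neg_sq, map_mul, Complex.conj_ofReal, conj_ringChar, mul_pow,
      inv_pow, zpow_ofNat]
    field_simp
    ring
  rw [ringDeriv, aggregationDeriv_apply, radialDeriv_apply, Fintype.sum_option]
  simp only [ringPlusCenter_some, ringPlusCenter_none, hterm, ← Finset.mul_sum,
    Finset.sum_sub_distrib, conj_ringCoeff, sub_self, zero_div, norm_zero, mul_zero]
  push_cast
  ring

theorem ringDeriv_apply_some (hR : 0 < R) (x : Option (Fin N) → ℂ) (j : Fin N) :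
    ringDeriv f c R N x (some j) = modeDiag f c R N * x (some j)
      + (deriv f R * R / 2 - c / R ^ 2 : ℝ) * (ringChar N j ^ 2 * conj (x (some j)))
      + (c / R ^ 2 : ℝ) * (ringChar N j ^ 2 * conj (x none)
        - ∑ k, (conj (x (some j)) - conj (x (some k)))
          / ((ringChar N j)⁻¹ - (ringChar N k)⁻¹) ^ 2) := by
  have hRC : (R : ℂ) ≠ 0 := Complex.ofReal_ne_zero.2 hR.ne'
  have hE := ((ringChar N).val_isUnit j).ne_zero
  have hterm (k : Fin N) : (conj (x (some j)) - conj (x (some k)))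
      / conj (R * ringChar N j - R * ringChar N k) ^ 2 = ((R : ℂ) ^ 2)⁻¹ *
        ((conj (x (some j)) - conj (x (some k))) / ((ringChar N j)⁻¹ - (ringChar N k)⁻¹) ^ 2) := by
    rw [← mul_sub, map_mul, Complex.conj_ofReal, map_sub, conj_ringChar, conj_ringChar, mul_pow,
      inv_mul_eq_div, div_div, mul_comm]
  rw [ringDeriv, aggregationDeriv_apply, radialDeriv_apply, Fintype.sum_option,
    norm_ringPlusCenter_some hR]
  simp only [ringPlusCenter_some, ringPlusCenter_none, hterm, ← Finset.mul_sum, sub_zero, map_mul,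
    Complex.conj_ofReal, conj_ringChar, mul_div_cancel_left₀ _ hRC, angularVelocity, modeDiag]
  push_cast
  field_simp
  ring

theorem ringCoeff_ringDeriv (hR : 0 < R) (x : Option (Fin N) → ℂ) {m : ℤ} (hm : m.natAbs ≤ N) :
    ringCoeff (ringDeriv f c R N x) (1 + m) = modeDiag f c R N * ringCoeff x (1 + m)
      + modeCoupling f c R N m.natAbs * conj (ringCoeff x (1 - m))
      + (c / R ^ 2 : ℝ) * conj (x none) * ∑ j, ringChar N j ^ (1 - m) := by
  have hzpow (j : Fin N) :
      ringChar N j ^ (-(1 + m)) * ringChar N j ^ 2 = ringChar N j ^ (1 - m) := by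
    rw [← zpow_natCast, ← zpow_add₀ ((ringChar N).val_isUnit j).ne_zero]
    congr 1
    push_cast
    ring
  have hinteraction : ∑ j, ringChar N j ^ (-(1 + m)) * ∑ k, (conj (x (some j)) - conj (x (some k)))
      / ((ringChar N j)⁻¹ - (ringChar N k)⁻¹) ^ 2
      = (1 - m.natAbs) * (N - 1 - m.natAbs) / 2 * conj (ringCoeff x (1 - m)) := by
    have hsum := sum_zpow_sub_zpow_div_inv_sub_inv_sq (ringChar_injective (N := N)) (m := m)
      (by rwa [Fintype.card_fin])
    simp only [div_eq_mul_inv _ (_ ^ 2)] at hsum ⊢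
    rw [sum_mul_sum_sub_mul_comm fun j k => by rw [← neg_sub, neg_sq]]
    simp only [hsum, conj_ringCoeff, Finset.mul_sum, Fintype.card_fin]
    exact Finset.sum_congr rfl fun j _ => by ring
  have hterm (j : Fin N) : ringChar N j ^ (-(1 + m)) * ringDeriv f c R N x (some j)
      = modeDiag f c R N * (ringChar N j ^ (-(1 + m)) * x (some j))
        + (deriv f R * R / 2 - c / R ^ 2 : ℝ) * (ringChar N j ^ (1 - m) * conj (x (some j)))
        + (c / R ^ 2 : ℝ) * conj (x none) * ringChar N j ^ (1 - m)
        - (c / R ^ 2 : ℝ) * (ringChar N j ^ (-(1 + m)) * ∑ k,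
          (conj (x (some j)) - conj (x (some k)))
            / ((ringChar N j)⁻¹ - (ringChar N k)⁻¹) ^ 2) := by
    rw [ringDeriv_apply_some hR, ← hzpow]
    ring
  rw [ringCoeff, ringCoeff]
  simp only [hterm, Finset.sum_sub_distrib, Finset.sum_add_distrib, ← Finset.mul_sum,
    hinteraction, ← conj_ringCoeff, modeCoupling]
  push_cast
  ring

end RingDeriv

section Sufficiency

variable {N : ℕ} [NeZero N] {f : ℝ → ℝ} {c R l : ℝ} {x : Option (Fin N) → ℂ}

theorem eq_zero_of_mul_eq_add_mul_conj {b g l : ℝ} {X Y : ℂ} (hadd : b + g < l)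
    (hsub : b - g < l) (hX : (l : ℂ) * X = b * X + g * conj Y)
    (hY : (l : ℂ) * Y = b * Y + g * conj X) : X = 0 := by
  have hY' : (l : ℂ) * conj Y = b * conj Y + g * X := by simpa using congr_arg conj hY
  have hplus : ((l - (b + g) : ℝ) : ℂ) * (X + conj Y) = 0 := by
    push_cast
    linear_combination hX + hY'
  have hminus : ((l - (b - g) : ℝ) : ℂ) * (X - conj Y) = 0 := by
    push_cast
    linear_combination hX - hY'
  rw [mul_eq_zero, Complex.ofReal_eq_zero, or_iff_right (sub_pos.2 ‹_›).ne'] at hplus hminus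
  linear_combination (hplus + hminus) / 2

theorem ringCoeff_of_ringDeriv_eq_smul (hR : 0 < R) (hx : ringDeriv f c R N x = l • x) {m : ℤ}
    (hm : m.natAbs ≤ N) : l * ringCoeff x (1 + m) = modeDiag f c R N * ringCoeff x (1 + m)
      + modeCoupling f c R N m.natAbs * conj (ringCoeff x (1 - m))
      + (c / R ^ 2 : ℝ) * conj (x none) * ∑ j, ringChar N j ^ (1 - m) := by
  rw [← ringCoeff_smul, ← hx, ringCoeff_ringDeriv hR x hm]

theorem ringCoeff_one_re_eq_zero (hN : 2 ≤ N) (hc : 0 < c) (hR : 0 < R)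
    (hlambda : lambdaPlusStar f c R N (N / 2) < 0) (hl : 0 ≤ l)
    (hx : ringDeriv f c R N x = l • x) : (ringCoeff x 1).re = 0 := by
  have hmode := congr_arg Complex.re (ringCoeff_of_ringDeriv_eq_smul hR hx (m := 0) (by simp))
  simp only [add_zero, sub_zero, zpow_one, sum_ringChar_eq_zero hN, mul_zero, Complex.add_re,
    Complex.re_ofReal_mul, Complex.conj_re, Int.natAbs_zero] at hmode
  have hneg := (lambdaPlusStar_le_half (f := f) (R := R) (N := N) hc.le 0).trans_lt hlambda
  rw [← modeDiag_add_modeCoupling] at hneg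
  have hfactor : (l - (modeDiag f c R N + modeCoupling f c R N 0)) * (ringCoeff x 1).re = 0 := by
    linear_combination hmode
  exact (mul_eq_zero.1 hfactor).resolve_left (by linarith)

theorem ringCoeff_one_add_eq_zero (hc : 0 < c) (hR : 0 < R)
    (hlambda : lambdaPlusStar f c R N (N / 2) < 0) (hl : 0 ≤ l)
    (hx : ringDeriv f c R N x = l • x) {m : ℕ} (hm : 2 ≤ m) (hmN : m + 2 ≤ N) :
    ringCoeff x (1 + m) = 0 := by
  have hresonance (n : ℤ) (hn : n.natAbs = m) : ∑ j, ringChar N j ^ (1 - n) = 0 :=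
    sum_ringChar_zpow_eq_zero fun h => by
      have := Int.natAbs_le_of_dvd_ne_zero h
      omega
  have hplus := ringCoeff_of_ringDeriv_eq_smul hR hx (m := m) (by omega)
  have hminus := ringCoeff_of_ringDeriv_eq_smul hR hx (m := -m) (by omega)
  rw [hresonance _ (by simp), mul_zero, add_zero, Int.natAbs_natCast] at hplus
  rw [hresonance _ (by simp), mul_zero, add_zero, sub_neg_eq_add, ← sub_eq_add_neg,
    Int.natAbs_neg, Int.natAbs_natCast] at hminus
  refine eq_zero_of_mul_eq_add_mul_conj ?_ ?_ hplus hminus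
  · rw [modeDiag_add_modeCoupling]
    exact ((lambdaPlusStar_le_half hc.le m).trans_lt hlambda).trans_le hl
  · rw [modeDiag_sub_modeCoupling]
    refine (neg_lt_zero.2 ?_).trans_le hl
    have hm0 : (0 : ℝ) < m := by exact_mod_cast (by omega : 0 < m)
    have hNm : (0 : ℝ) < N - m := sub_pos.2 (by exact_mod_cast (by omega : m < N))
    exact mul_pos (div_pos hc (pow_pos hR 2)) (half_pos (mul_pos hm0 hNm))

theorem central_modes_eq_zero (hN : 3 ≤ N) (hR : 0 < R) (hM0 : AllEigenvaluesNegative (M0 f c R N))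
    (hl : 0 ≤ l) (hx : ringDeriv f c R N x = l • x) :
    ringCoeff x 2 = 0 ∧ ringCoeff x 0 = 0 ∧ x none = 0 := by
  have hsum : ∑ j, ringChar N j ^ (2 : ℤ) = 0 := sum_ringChar_zpow_eq_zero fun h => by
    have := Int.le_of_dvd two_pos h
    omega
  have htwo := ringCoeff_of_ringDeriv_eq_smul hR hx (m := 1) (by omega)
  have hzero := ringCoeff_of_ringDeriv_eq_smul hR hx (m := -1) (by omega)
  have hnone := congr_fun hx none
  rw [one_add_one_eq_two, sub_self, Int.natAbs_one] at htwo
  rw [add_neg_cancel, sub_neg_eq_add, one_add_one_eq_two, hsum, mul_zero, add_zero] at hzero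
  rw [ringDeriv_apply_none, hsum, mul_zero, sub_zero] at hnone
  simp only [zpow_zero, Finset.sum_const, Finset.card_univ, Fintype.card_fin, nsmul_eq_mul,
    mul_one] at htwo
  have hzero' : l * conj (ringCoeff x 0) = modeDiag f c R N * conj (ringCoeff x 0)
      + modeCoupling f c R N 1 * ringCoeff x 2 := by
    simpa using congr_arg conj hzero
  have hnone' : (f 0 - angularVelocity f c R N : ℝ) * conj (x none)
      + (c / R ^ 2 : ℝ) * ringCoeff x 2 = l * conj (x none) := by
    simpa using congr_arg conj hnone
  have hblock : ((M0 f c R N).map fun a : ℝ => (a : ℂ)).mulVec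
      ![ringCoeff x 2, conj (ringCoeff x 0), N * conj (x none)]
      = (l : ℂ) • ![ringCoeff x 2, conj (ringCoeff x 0), N * conj (x none)] := by
    rw [M0_eq]
    ext i
    simp only [Matrix.mulVec, dotProduct, Fin.sum_univ_three, Matrix.map_apply, Pi.smul_apply,
      smul_eq_mul]
    fin_cases i <;> simp only [Matrix.of_apply, Matrix.cons_val, Fin.reduceFinMk, Fin.zero_eta,
      Fin.mk_one, Complex.ofReal_zero, zero_mul, Complex.ofReal_mul, Complex.ofReal_natCast]
    · linear_combination -htwo
    · linear_combination -hzero'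
    · linear_combination (N : ℂ) * hnone'
  have hkernel := eq_zero_of_mulVec_eq_smul hM0 hl hblock
  have hN0 : (N : ℂ) ≠ 0 := Nat.cast_ne_zero.2 (by omega)
  exact ⟨by simpa using congr_fun hkernel 0, by simpa using congr_fun hkernel 1,
    by simpa [hN0] using congr_fun hkernel 2⟩

theorem mem_span_rotationMode_of_ringDeriv_eq_smul (hN : 3 ≤ N) (hc : 0 < c) (hR : 0 < R)
    (hcriterion : StabilityCriterion f c R N) (hl : 0 ≤ l) (hx : ringDeriv f c R N x = l • x) :
    x ∈ Submodule.span ℝ {rotationMode (ringPlusCenter N R)} := by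
  obtain ⟨hlambda, hM0⟩ := hcriterion
  obtain ⟨htwo, hzero, hnone⟩ := central_modes_eq_zero hN hR hM0 hl hx
  have hcoeff (n : ℕ) (hn : n ∈ Finset.range N) (hn1 : n ≠ 1) : ringCoeff x n = 0 := by
    rw [Finset.mem_range] at hn
    obtain rfl | rfl | hn2 : n = 0 ∨ n = 2 ∨ 3 ≤ n := by omega
    · exact hzero
    · exact htwo
    · have := ringCoeff_one_add_eq_zero hc hR hlambda hl hx (m := n - 1) (by omega) (by omega)
      rwa [← Nat.cast_one, ← Nat.cast_add, Nat.add_sub_cancel' (by omega)] at this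
  have hone : ringCoeff x 1 = Complex.I * (ringCoeff x 1).im :=
    Complex.ext (by simp [ringCoeff_one_re_eq_zero (by omega) hc hR hlambda hl hx]) (by simp)
  have hsome (j : Fin N) :
      (N : ℂ) * x (some j) = ringChar N j * (Complex.I * (ringCoeff x 1).im) := by
    rw [← sum_ringChar_pow_mul_ringCoeff, Finset.sum_eq_single_of_mem 1
      (Finset.mem_range.2 (by omega)) fun n hn hn1 => by rw [hcoeff n hn hn1, mul_zero]]
    rw [pow_one, Nat.cast_one, ← hone]
  rw [Submodule.mem_span_singleton]
  refine ⟨(ringCoeff x 1).im / (N * R), funext ?_⟩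
  rintro (_ | j)
  · simp [rotationMode, ringPlusCenter_none, hnone]
  · have hN0 : (N : ℂ) ≠ 0 := Nat.cast_ne_zero.2 (NeZero.ne N)
    have hRC : (R : ℂ) ≠ 0 := Complex.ofReal_ne_zero.2 hR.ne'
    refine mul_left_cancel₀ hN0 ?_
    simp only [hsome, Pi.smul_apply, rotationMode, ringPlusCenter_some, Complex.real_smul]
    push_cast
    field_simp

theorem isLinearlyStable_of_stabilityCriterion (hN : 3 ≤ N) (hc : 0 < c) (hR : 0 < R)
    (hf0 : ContinuousWithinAt f (Set.Ici 0) 0) (hfR : DifferentiableAt ℝ f R)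
    (hcriterion : StabilityCriterion f c R N) :
    IsLinearlyStable (aggregationField f c (angularVelocity f c R N)) (ringPlusCenter N R) := by
  have hrotation : Submodule.span ℝ {rotationMode (ringPlusCenter N R)}
      ≤ LinearMap.ker (ringDeriv f c R N : (Option (Fin N) → ℂ) →ₗ[ℝ] Option (Fin N) → ℂ) := by
    rw [Submodule.span_singleton_le_iff_mem]
    exact ringDeriv_rotationMode (by omega) hR
  rw [isLinearlyStable_iff (hasFDerivAt_aggregationField_ringPlusCenter hR hf0 hfR)
    ringDeriv_isSelfAdjoint]
  refine ⟨(aggregationField_ringPlusCenter_eq_zero_iff (by omega) hR).2 rfl, fun l hl => ?_,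
    le_antisymm (fun x hx => ?_) hrotation⟩
  · by_contra! hpos
    obtain ⟨x, hx⟩ := hl.exists_hasEigenvector
    have hker := hrotation
      (mem_span_rotationMode_of_ringDeriv_eq_smul hN hc hR hcriterion hpos.le hx.apply_eq_smul)
    have hzero : l • x = 0 := hx.apply_eq_smul.symm.trans hker
    exact (smul_ne_zero hpos.ne' hx.2) hzero
  · refine mem_span_rotationMode_of_ringDeriv_eq_smul hN hc hR hcriterion le_rfl ?_
    rw [zero_smul]
    exact hx

end Sufficiency

section Necessity

variable {N : ℕ} [NeZero N] {f : ℝ → ℝ} {c R : ℝ}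

theorem exists_of_mem_span_rotationMode {v : Option (Fin N) → ℂ}
    (hv : v ∈ Submodule.span ℝ {rotationMode (ringPlusCenter N R)}) :
    v none = 0 ∧ ∃ t : ℝ, ∀ j, v (some j) = Complex.I * t * ringChar N j := by
  obtain ⟨t, rfl⟩ := Submodule.mem_span_singleton.1 hv
  refine ⟨by simp [rotationMode, ringPlusCenter_none], t * R, fun j => ?_⟩
  simp only [Pi.smul_apply, rotationMode, ringPlusCenter_some, Complex.real_smul]
  push_cast
  ring

theorem ringMode_notMem_span_rotationMode (m : ℤ) {a b : ℂ} (h : ℂ) (hab : (a + b).re ≠ 0) :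
    ringMode N m a b h ∉ Submodule.span ℝ {rotationMode (ringPlusCenter N R)} := by
  intro hv
  obtain ⟨-, t, ht⟩ := exists_of_mem_span_rotationMode hv
  refine hab ?_
  simpa [ringMode] using congr_arg Complex.re (ht 0)

theorem lambdaPlusStar_neg_of_isLinearlyStable (hR : 0 < R)
    (hf0 : ContinuousWithinAt f (Set.Ici 0) 0) (hfR : DifferentiableAt ℝ f R)
    (hstable : IsLinearlyStable (aggregationField f c (angularVelocity f c R N))
      (ringPlusCenter N R)) {m : ℕ} (hm : m ≤ N) : lambdaPlusStar f c R N m < 0 := by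
  let v := ringMode N m 1 1 0
  have hv : v ∉ Submodule.span ℝ {rotationMode (ringPlusCenter N R)} :=
    ringMode_notMem_span_rotationMode _ _ (by norm_num)
  have hneg := realDot_apply_self_neg (hasFDerivAt_aggregationField_ringPlusCenter hR hf0 hfR)
    ringDeriv_isSelfAdjoint hstable hv
  have hpos : 0 < realDot v v :=
    realDot_posDef v fun h => hv (h ▸ Submodule.zero_mem _)
  have hplus := ringCoeff_ringDeriv (f := f) (c := c) hR v (m := m) (by simpa using hm)
  have hminus := ringCoeff_ringDeriv (f := f) (c := c) hR v (m := -m) (by simpa using hm)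
  have heigen : realDot v (ringDeriv f c R N v) = lambdaPlusStar f c R N m * realDot v v := by
    rw [sub_neg_eq_add, ← sub_eq_add_neg, Int.natAbs_neg] at hminus
    simp only [v, realDot_ringMode, hplus, hminus, ← modeDiag_add_modeCoupling]
    simp only [map_one, Int.natAbs_natCast, Complex.ofReal_div, Complex.ofReal_pow, ringMode,
      map_zero, mul_zero, zero_mul, add_zero, one_mul, Complex.add_re, Complex.mul_re,
      Complex.ofReal_re, Complex.ofReal_im, sub_zero, Complex.conj_re, Complex.conj_im, mul_neg,
      neg_zero]
    ring
  rw [heigen] at hneg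
  exact (neg_iff_pos_of_mul_neg hneg).2 hpos

/-- The configuration in the modes `2` and `0` and the central vortex on which the linearization
acts through `M0`: up to the factor `N`, it has `(X 2, conj (X 0), conj h) = z u`. -/
noncomputable def centralMode (N : ℕ) [NeZero N] (z : ℂ) (u : Fin 3 → ℝ) : Option (Fin N) → ℂ :=
  ringMode N 1 (z * u 0) (conj z * u 1) (conj z * u 2)

theorem ringCoeff_centralMode_two {r : ℝ} (hr : ∑ j, ringChar N j ^ (2 : ℤ) = r) (z : ℂ)
    (u : Fin 3 → ℝ) : ringCoeff (centralMode N z u) 2 = z * u 0 * N + conj z * u 1 * r := by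
  have hr' : ∑ j, ringChar N j ^ (-2 : ℤ) = r := by
    have := congr_arg conj hr
    simpa only [map_sum, map_zpow₀, conj_ringChar, inv_zpow', Complex.conj_ofReal] using this
  rw [centralMode, ringCoeff_ringMode, one_add_one_eq_two, sub_self, sub_self, zero_sub, hr']
  simp

theorem ringCoeff_centralMode_zero {r : ℝ} (hr : ∑ j, ringChar N j ^ (2 : ℤ) = r) (z : ℂ)
    (u : Fin 3 → ℝ) : ringCoeff (centralMode N z u) 0 = z * u 0 * r + conj z * u 1 * N := by
  rw [centralMode, ringCoeff_ringMode, one_add_one_eq_two, sub_self, sub_zero, sub_zero, hr]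
  simp

theorem realDot_ringDeriv_centralMode (hR : 0 < R) {r : ℝ}
    (hr : ∑ j, ringChar N j ^ (2 : ℤ) = r) (z : ℂ) (u : Fin 3 → ℝ) :
    realDot (centralMode N z u) (ringDeriv f c R N (centralMode N z u))
      = Complex.normSq z * centralForm N u ((M0 f c R N).mulVec u)
        + (z ^ 2).re * (r * (2 * modeDiag f c R N * (u 0 * u 1)
          + modeCoupling f c R N 1 * (u 0 ^ 2 + u 1 ^ 2)
          + c / R ^ 2 * (2 * u 1 * u 2 - u 2 ^ 2))) := by
  have hone : 1 ≤ N := NeZero.one_le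
  have htwo := ringCoeff_ringDeriv (f := f) (c := c) hR (centralMode N z u) (m := 1) hone
  have hzero := ringCoeff_ringDeriv (f := f) (c := c) hR (centralMode N z u) (m := -1)
    (by simpa using hone)
  have hcard : ∑ j, ringChar N j ^ (0 : ℤ) = N := by simp
  rw [one_add_one_eq_two, sub_self, hcard, ringCoeff_centralMode_two hr,
    ringCoeff_centralMode_zero hr, Int.natAbs_one] at htwo
  rw [add_neg_cancel, sub_neg_eq_add, one_add_one_eq_two, hr, ringCoeff_centralMode_two hr,
    ringCoeff_centralMode_zero hr, Int.natAbs_neg, Int.natAbs_one] at hzero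
  nth_rewrite 1 [centralMode]
  rw [realDot_ringMode, one_add_one_eq_two, sub_self, htwo, hzero, ringDeriv_apply_none, hr,
    ringCoeff_centralMode_two hr, centralForm_apply, M0_mulVec]
  generalize c / R ^ 2 = s
  simp only [map_mul, Complex.conj_ofReal, map_add, Complex.conj_conj, map_natCast, centralMode,
    ringMode, Complex.ofReal_sub, Complex.add_re, Complex.mul_re, Complex.conj_re,
    Complex.ofReal_re, Complex.conj_im, Complex.ofReal_im, mul_zero, sub_zero, Complex.natCast_re,
    Complex.mul_im, zero_add, Complex.natCast_im, neg_mul, Complex.add_im, zero_mul, add_zero,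
    sub_neg_eq_add, Complex.sub_re, Complex.sub_im, sub_self, mul_neg, neg_zero,
    Complex.normSq_apply, Matrix.cons_val, pow_two]
  ring

theorem eq_zero_of_centralMode_mem_span (hN : 2 ≤ N) {u : Fin 3 → ℝ}
    (hreal : centralMode N 1 u ∈ Submodule.span ℝ {rotationMode (ringPlusCenter N R)})
    (himag : centralMode N Complex.I u ∈ Submodule.span ℝ {rotationMode (ringPlusCenter N R)}) :
    u = 0 := by
  have hsum : u 0 + u 1 = 0 := by
    by_contra h
    exact ringMode_notMem_span_rotationMode 1 _ (by simpa using h) hreal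
  have htwo : u 2 = 0 := by
    simpa [centralMode, ringMode] using (exists_of_mem_span_rotationMode hreal).1
  obtain ⟨-, t, ht⟩ := exists_of_mem_span_rotationMode himag
  have hone : (u 1 : ℂ) = -u 0 := by
    rw [← Complex.ofReal_neg, ← eq_neg_of_add_eq_zero_right hsum]
  let k : Fin N := ⟨1, hN⟩
  have hmode (j : Fin N) :
      Complex.I * u 0 * (ringChar N j ^ 2 + 1) = Complex.I * t * ringChar N j := by
    rw [← ht j, centralMode, ringMode, hone, one_add_one_eq_two, sub_self, zpow_ofNat, zpow_zero,
      Complex.conj_I]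
    ring
  have hzero := hmode 0
  rw [AddChar.map_zero_eq_one] at hzero
  have hk : Complex.I * u 0 * (1 - ringChar N k) ^ 2 = 0 := by
    linear_combination hmode k - ringChar N k * hzero
  have hk0 : k ≠ 0 := Fin.ne_of_val_ne one_ne_zero
  have hu0 : u 0 = 0 := by
    simpa [one_sub_addChar_ne_zero ringChar_injective hk0] using hk
  ext i
  fin_cases i
  · exact hu0
  · exact (eq_neg_of_add_eq_zero_right hsum).trans (neg_eq_zero.2 hu0)
  · exact htwo

theorem allEigenvaluesNegative_M0_of_isLinearlyStable (hN : 2 ≤ N) (hR : 0 < R)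
    (hf0 : ContinuousWithinAt f (Set.Ici 0) 0) (hfR : DifferentiableAt ℝ f R)
    (hstable : IsLinearlyStable (aggregationField f c (angularVelocity f c R N))
      (ringPlusCenter N R)) : AllEigenvaluesNegative (M0 f c R N) := by
  refine allEigenvaluesNegative_of_apply_self_neg centralForm_posDef M0_isSelfAdjoint
    fun u hu => ?_
  have hF := hasFDerivAt_aggregationField_ringPlusCenter (N := N) (c := c) hR hf0 hfR
  have hneg {v : Option (Fin N) → ℂ}
      (hv : v ∉ Submodule.span ℝ {rotationMode (ringPlusCenter N R)}) :
      realDot v (ringDeriv f c R N v) < 0 :=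
    realDot_apply_self_neg hF ringDeriv_isSelfAdjoint hstable hv
  have hnonpos := realDot_apply_self_nonpos hF ringDeriv_isSelfAdjoint hstable
  obtain ⟨r, hr⟩ := Complex.conj_eq_iff_real.1 (conj_sum_ringChar_zpow (N := N) 2)
  have hone := realDot_ringDeriv_centralMode (f := f) (c := c) hR hr 1 u
  have hI := realDot_ringDeriv_centralMode (f := f) (c := c) hR hr Complex.I u
  rw [Complex.normSq_one, one_pow, Complex.one_re] at hone
  rw [Complex.normSq_I, Complex.I_sq, Complex.neg_re, Complex.one_re] at hI
  change centralForm N u ((M0 f c R N).mulVec u) < 0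
  by_cases hreal : centralMode N 1 u ∈ Submodule.span ℝ {rotationMode (ringPlusCenter N R)}
  · have himag := mt (eq_zero_of_centralMode_mem_span hN hreal) hu
    linarith [hnonpos (centralMode N 1 u), hneg himag]
  · linarith [hneg hreal, hnonpos (centralMode N Complex.I u)]

theorem stabilityCriterion_of_isLinearlyStable (hN : 2 ≤ N) (hR : 0 < R)
    (hf0 : ContinuousWithinAt f (Set.Ici 0) 0) (hfR : DifferentiableAt ℝ f R)
    (hstable : IsLinearlyStable (aggregationField f c (angularVelocity f c R N))
      (ringPlusCenter N R)) : StabilityCriterion f c R N :=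
  ⟨lambdaPlusStar_neg_of_isLinearlyStable hR hf0 hfR hstable (Nat.div_le_self N 2),
    allEigenvaluesNegative_M0_of_isLinearlyStable hN hR hf0 hfR hstable⟩

end Necessity

end Vortex

theorem theorem3 (N : ℕ) (hN : 2 ≤ N) (f : ℝ → ℝ) (c R : ℝ) (hc : 0 < c) (hR : 0 < R)
    (hf0 : ContinuousWithinAt f (Set.Ici 0) 0) (hfR : DifferentiableAt ℝ f R) :
    (∀ ω : ℝ, Vortex.IsVortexSolution f c (Vortex.rotatingRingPlusCenter N R ω) ↔
      ω = f R + c / (2 * R ^ 2) * ((N : ℝ) + 1)) ∧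
    ∀ ω : ℝ, ω = f R + c / (2 * R ^ 2) * ((N : ℝ) + 1) →
      (3 ≤ N →
        (Vortex.IsLinearlyStable (Vortex.aggregationField f c ω) (Vortex.ringPlusCenter N R) ↔
          Vortex.StabilityCriterion f c R N)) ∧
      (N = 2 →
        Vortex.IsLinearlyStable (Vortex.aggregationField f c ω) (Vortex.ringPlusCenter N R) →
          Vortex.StabilityCriterion f c R N) ∧
      (Vortex.IsLinearlyStable (Vortex.aggregationField f c ω) (Vortex.ringPlusCenter N R) →
        Vortex.IsNeutrallyStable (Vortex.rotatingVortexField f c ω)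
          (Vortex.ringPlusCenter N R)) := by
  have : NeZero N := ⟨by omega⟩
  refine ⟨fun ω => Vortex.isVortexSolution_rotating_iff.trans
    (Vortex.aggregationField_ringPlusCenter_eq_zero_iff hN hR), ?_⟩
  rintro _ rfl
  have hnecessary := Vortex.stabilityCriterion_of_isLinearlyStable (c := c) hN hR hf0 hfR
  refine ⟨fun hN3 => ⟨hnecessary,
    Vortex.isLinearlyStable_of_stabilityCriterion hN3 hc hR hf0 hfR⟩, fun _ => hnecessary,
    fun hstable => ?_⟩
  have hfield : Vortex.rotatingVortexField (ι := Option (Fin N)) f c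
      (Vortex.angularVelocity f c R N) = fun y =>
        Vortex.rotationMode (Vortex.aggregationField f c (Vortex.angularVelocity f c R N) y) :=
    funext fun _ => Vortex.rotatingVortexField_eq_rotationMode
  exact hfield ▸ Vortex.isNeutrallyStable_rotationMode_comp
    (Vortex.hasFDerivAt_aggregationField_ringPlusCenter hR hf0 hfR)
    Vortex.ringDeriv_isSelfAdjoint hstable
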